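/- **Theorem 1.5.** Let $p$ be an odd prime, let $k\ge 0$ and $n\geq 1$, and let $B=\mathbb{R}^n/\Gamma$ be a compact flat $n$-manifold, where $\Gamma$ is a group of Euclidean isometries acting properly discontinuously, freely and cocompactly on $\mathbb{R}^n$. Suppose that the holonomy group of $B$ (the group of linear parts of the elements of $\Gamma$) is isomorphic to $(C_p)^k$, where $C_p$ is the cyclic group of order $p$, and that the first Betti number $b_1(B)=\dim_{\mathbb{Q}} H_1(B;\mathbb{Q})$ is $0$. Let $q$ be a rational quadratic form of signature $(n+1,1)$, and suppose that $B$ appears as a cusp cross-section in the commensurability class of arithmetic hyperbolic $(n+1)$-manifolds of simplest type defined by $q$. Then $n\equiv 0$ or $n\equiv p-1 \pmod{2(p-1)}$, and the discriminant of $q$ is $$d(q)=\begin{cases}-1 & \text{if } n\equiv 0 \bmod 2(p-1),\\ -p & \text{if } n\equiv p-1 \bmod 2(p-1)\end{cases}\qquad\text{in } \mathbb{Q}^\times/(\mathbb{Q}^\times)^2 .$$ Here $d(q)$ is the class of the determinant of the symmetric matrix of $q$. Let $\mathbb{H}_q\subset\{x\in\mathbb{R}^{n+2} : q(x)=-1\}$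 be the hyperboloid model of hyperbolic $(n+1)$-space defined by $q$ (one of the two sheets), let $O^+(q;\mathbb{R})$ be the group of real matrices preserving $q$ and $\mathbb{H}_q$, and let $O^+(q;\mathbb{Z})=O^+(q;\mathbb{R})\cap GL_{n+2}(\mathbb{Z})$. The manifolds in the class defined by $q$ are the quotients $\mathbb{H}_q/\Delta$ with $\Delta\le O^+(q;\mathbb{R})$ torsion-free and commensurable with $O^+(q;\mathbb{Z})$. The manifold $B$ appears as a cusp cross-section in the class if, for some such $\Delta$ and some non-zero $y\in\mathbb{R}^{n+2}$ with $q(y)=0$, it is homeomorphic to the quotient of the horosphere $\{x\in\mathbb{H}_q : x^{T}Qy=-1\}$ by $\{g\in\Delta : gy=y\}$, where $Q$ is the symmetric matrix of $q$. -/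

import Mathlib

open scoped Matrix

noncomputable section

/-! ### Compact flat manifolds -/

/-- Euclidean `n`-space. -/
abbrev Euc (n : ℕ) : Type := EuclideanSpace ℝ (Fin n)

/-- The group of isometries of Euclidean space acts on Euclidean space by evaluation. -/
instance eucMulAction (n : ℕ) : MulAction (Euc n ≃ᵃⁱ[ℝ] Euc n) (Euc n) where
  smul g x := g x
  one_smul _ := rfl
  mul_smul _ _ _ := rfl

/-- The homomorphism sending a Euclidean isometry `x ↦ A x + v` to its linear part `A`. -/
def linearPart (n : ℕ) : (Euc n ≃ᵃⁱ[ℝ] Euc n) →* (Euc n ≃ₗᵢ[ℝ] Euc n) where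
  toFun g := g.linearIsometryEquiv
  map_one' := rfl
  map_mul' _ _ := rfl

/-- A compact flat `n`-manifold, presented as a Euclidean space form `ℝⁿ / Γ`: here `Γ` is a group
of isometries of `ℝⁿ` acting properly discontinuously, freely, and with compact quotient. -/
structure CompactFlatManifold (n : ℕ) where
  /-- the group of deck transformations of the universal covering `ℝⁿ → ℝⁿ / Γ` -/
  Γ : Subgroup (Euc n ≃ᵃⁱ[ℝ] Euc n)
  properlyDiscontinuous : ProperlyDiscontinuousSMul Γ (Euc n)
  free : ∀ γ ∈ Γ, ∀ x : Euc n, γ x = x → γ = 1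
  compact : CompactSpace (MulAction.orbitRel.Quotient Γ (Euc n))

namespace CompactFlatManifold

variable {n : ℕ} (B : CompactFlatManifold n)

/-- The underlying topological space `ℝⁿ / Γ`. -/
abbrev Space : Type := MulAction.orbitRel.Quotient B.Γ (Euc n)

/-- The holonomy group: the group of linear parts of the elements of `Γ`. -/
def holonomyGroup : Subgroup (Euc n ≃ₗᵢ[ℝ] Euc n) := B.Γ.map (linearPart n)

/-- The first Betti number `dim H₁(B; ℚ)` (singular homology), as a cardinal. -/
def b₁ : Cardinal :=
  Module.rank ℚ
    (((AlgebraicTopology.singularHomologyFunctor (ModuleCat.{0} ℚ) 1).obj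
      (ModuleCat.of ℚ ℚ)).obj (TopCat.of B.Space))

end CompactFlatManifold

/-! ### Rational quadratic forms -/

/-- `q` has signature `(r, s)` (so it is non-degenerate if `r + s` is its rank `m`). -/
def HasSignature {m : ℕ} (q : QuadraticForm ℚ (Fin m → ℚ)) (r s : ℕ) : Prop :=
  sigPos q = r ∧ sigNeg q = s

/-- `d(q) = d` in `ℚˣ / (ℚˣ)²`, for a non-zero rational number `d`; here `d(q)` is the class of the
determinant of the symmetric matrix of `q`. -/
def HasDiscriminant {m : ℕ} (q : QuadraticForm ℚ (Fin m → ℚ)) (d : ℚ) : Prop :=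
  ∃ r : ℚ, r ≠ 0 ∧ q.discr' = d * r ^ 2

/-- The symmetric matrix `Q` with `q(v) = vᵀ Q v`, viewed as a real matrix. -/
def gramMatrix {m : ℕ} (q : QuadraticForm ℚ (Fin m → ℚ)) : Matrix (Fin m) (Fin m) ℝ :=
  q.toMatrix'.map (fun a : ℚ => (a : ℝ))

/-- The real bilinear form `(x, y) ↦ xᵀ Q y` of `q`. -/
def realBilin {m : ℕ} (q : QuadraticForm ℚ (Fin m → ℚ)) (x y : Fin m → ℝ) : ℝ :=
  x ⬝ᵥ (gramMatrix q *ᵥ y)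

/-! ### Hyperbolic space -/

/-- The matrix of the form `q₀ = ⟨1, …, 1, -1⟩` of signature `(n + 1, 1)`. -/
def standardGram (n : ℕ) : Matrix (Fin (n + 2)) (Fin (n + 2)) ℝ :=
  Matrix.diagonal (fun i => if i = Fin.last (n + 1) then -1 else 1)

/-- The hyperboloid model `{x | q₀(x) = -1, x_{n+2} > 0}` of hyperbolic `(n + 1)`-space. -/
def standardHyperboloid (n : ℕ) : Set (Fin (n + 2) → ℝ) :=
  {x | x ⬝ᵥ (standardGram n *ᵥ x) = -1 ∧ 0 < x (Fin.last (n + 1))}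

/-- `q₀(x) = q(A x)` for all `x`, in terms of matrices. -/
def IsModelMatrix {n : ℕ} (q : QuadraticForm ℚ (Fin (n + 2) → ℚ))
    (A : GL (Fin (n + 2)) ℝ) : Prop :=
  (A.val)ᵀ * gramMatrix q * A.val = standardGram n

/-- The model `A ℍ` of hyperbolic space inside `{x | q(x) = -1}`, where `q₀(x) = q(A x)`. -/
def hyperboloid {n : ℕ} (A : GL (Fin (n + 2)) ℝ) : Set (Fin (n + 2) → ℝ) :=
  (fun x => A.val *ᵥ x) '' standardHyperboloid n

/-- The group `O⁺(q; ℝ)` of real matrices that preserve `q` and the hyperbolic space `A ℍ`. -/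
def OPlus {n : ℕ} (q : QuadraticForm ℚ (Fin (n + 2) → ℚ)) (A : GL (Fin (n + 2)) ℝ) :
    Subgroup (GL (Fin (n + 2)) ℝ) where
  carrier := {g | (g.val)ᵀ * gramMatrix q * g.val = gramMatrix q ∧
    (fun x => g.val *ᵥ x) '' hyperboloid A = hyperboloid A}
  one_mem' := by simp
  mul_mem' := by
    rintro a b ⟨ha, ha'⟩ ⟨hb, hb'⟩
    refine ⟨?_, ?_⟩
    · calc ((a * b).val)ᵀ * gramMatrix q * (a * b).val
          = (b.val)ᵀ * ((a.val)ᵀ * gramMatrix q * a.val) * b.val := by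
            simp only [Units.val_mul, Matrix.transpose_mul, Matrix.mul_assoc]
        _ = gramMatrix q := by rw [ha, hb]
    · have h : (fun x => (a * b).val *ᵥ x)
          = (fun x => a.val *ᵥ x) ∘ (fun x => b.val *ᵥ x) := by
        funext x
        simp [Matrix.mulVec_mulVec]
      rw [h, Set.image_comp, hb', ha']
  inv_mem' := by
    rintro a ⟨ha, ha'⟩
    have h1 : a.val * (a⁻¹).val = 1 := by rw [← Units.val_mul, mul_inv_cancel, Units.val_one]
    have h2 : (a⁻¹).val * a.val = 1 := by rw [← Units.val_mul, inv_mul_cancel, Units.val_one]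
    refine ⟨?_, ?_⟩
    · calc ((a⁻¹).val)ᵀ * gramMatrix q * (a⁻¹).val
          = ((a⁻¹).val)ᵀ * ((a.val)ᵀ * gramMatrix q * a.val) * (a⁻¹).val := by rw [ha]
        _ = (a.val * (a⁻¹).val)ᵀ * gramMatrix q * (a.val * (a⁻¹).val) := by
            simp only [Matrix.transpose_mul, Matrix.mul_assoc]
        _ = gramMatrix q := by rw [h1]; simp
    · have h : (fun x => (a⁻¹).val *ᵥ x) ∘ (fun x => a.val *ᵥ x) = id := by
        funext x
        simp only [Function.comp_apply, Matrix.mulVec_mulVec, h2, Matrix.one_mulVec, id]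
      conv_lhs => rw [← ha']
      rw [← Set.image_comp, h, Set.image_id]

/-- The group `O⁺(q; ℤ) = O⁺(q; ℝ) ∩ GL(ℤ)`. -/
def OPlusInt {n : ℕ} (q : QuadraticForm ℚ (Fin (n + 2) → ℚ)) (A : GL (Fin (n + 2)) ℝ) :
    Subgroup (GL (Fin (n + 2)) ℝ) :=
  OPlus q A ⊓ (Matrix.GeneralLinearGroup.map (n := Fin (n + 2)) (Int.castRingHom ℝ)).range

/-! ### Arithmetic hyperbolic manifolds and their cusp cross-sections -/

/-- An arithmetic hyperbolic `(n + 1)`-manifold `A ℍ / Δ` of simplest type in the commensurability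
class defined by `q`: the group `Δ ≤ O⁺(q; ℝ)` is torsion-free and commensurable with
`O⁺(q; ℤ)`. -/
structure ArithmeticHyperbolicManifold {n : ℕ} (q : QuadraticForm ℚ (Fin (n + 2) → ℚ)) where
  /-- the matrix that carries the standard hyperboloid to the model defined by `q` -/
  A : GL (Fin (n + 2)) ℝ
  isModelMatrix : IsModelMatrix q A
  /-- the fundamental group -/
  Δ : Subgroup (GL (Fin (n + 2)) ℝ)
  le_OPlus : Δ ≤ OPlus q A
  commensurable : Subgroup.Commensurable Δ (OPlusInt q A)
  torsionFree : ∀ g ∈ Δ, IsOfFinOrder g → g = 1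

namespace ArithmeticHyperbolicManifold

variable {n : ℕ} {q : QuadraticForm ℚ (Fin (n + 2) → ℚ)} (M : ArithmeticHyperbolicManifold q)

/-- A horosphere of the hyperbolic space of `M` based at the boundary point given by the line
through the light-like vector `y`. The horospheres based at this point are the ones obtained by
rescaling `y` by positive numbers; the set is empty if `y` points to the opposite half of the
light cone. -/
def horosphere (y : Fin (n + 2) → ℝ) : Set (Fin (n + 2) → ℝ) :=
  {x | x ∈ hyperboloid M.A ∧ realBilin q x y = -1}

/-- The subgroup of `Δ` that preserves the horospheres based at `y`, that is, the intersection of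
`Δ` with the maximal parabolic subgroup `{g ∈ O⁺(q; ℝ) | g y = y}`. -/
def cuspGroup (y : Fin (n + 2) → ℝ) : Subgroup (GL (Fin (n + 2)) ℝ) where
  carrier := {g | g ∈ M.Δ ∧ g.val *ᵥ y = y}
  one_mem' := ⟨one_mem _, by simp⟩
  mul_mem' := by
    rintro a b ⟨ha, ha'⟩ ⟨hb, hb'⟩
    refine ⟨mul_mem ha hb, ?_⟩
    rw [Units.val_mul, ← Matrix.mulVec_mulVec, hb', ha']
  inv_mem' := by
    rintro a ⟨ha, ha'⟩
    refine ⟨inv_mem ha, ?_⟩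
    conv_lhs => rw [← ha']
    rw [Matrix.mulVec_mulVec, ← Units.val_mul, inv_mul_cancel, Units.val_one, Matrix.one_mulVec]

theorem mulVec_mem_horosphere {y : Fin (n + 2) → ℝ} {g : GL (Fin (n + 2)) ℝ}
    (hg : g ∈ M.cuspGroup y) {x : Fin (n + 2) → ℝ} (hx : x ∈ M.horosphere y) :
    g.val *ᵥ x ∈ M.horosphere y := by
  obtain ⟨hgΔ, hgy⟩ := hg
  obtain ⟨hQ, hH⟩ := M.le_OPlus hgΔ
  refine ⟨?_, ?_⟩
  · rw [← hH]
    exact ⟨x, hx.1, rfl⟩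
  · have h : realBilin q (g.val *ᵥ x) (g.val *ᵥ y) = realBilin q x y := by
      unfold realBilin
      conv_rhs => rw [← hQ]
      rw [Matrix.mulVec_mulVec, ← Matrix.mulVec_mulVec, ← Matrix.mulVec_mulVec,
        ← Matrix.mulVec_mulVec, Matrix.dotProduct_mulVec x (g.val)ᵀ, Matrix.vecMul_transpose]
    rw [hgy] at h
    rw [h]
    exact hx.2

/-- The group of a cusp acts on the horospheres based at the cusp point. -/
instance horosphereMulAction (y : Fin (n + 2) → ℝ) :
    MulAction (M.cuspGroup y) (M.horosphere y) where
  smul g x := ⟨g.val.val *ᵥ x.val, M.mulVec_mem_horosphere g.property x.property⟩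
  one_smul x := Subtype.ext (Matrix.one_mulVec x.val)
  mul_smul g h x := Subtype.ext (Matrix.mulVec_mulVec x.val g.val.val h.val.val).symm

/-- The quotient of a horosphere by the group of the cusp. -/
abbrev CrossSection (y : Fin (n + 2) → ℝ) : Type :=
  MulAction.orbitRel.Quotient (M.cuspGroup y) (M.horosphere y)

end ArithmeticHyperbolicManifold

/-- `B` arises as a cusp cross-section in the commensurability class of arithmetic hyperbolic
manifolds defined by `q`. As `B` is compact and non-empty, the homeomorphism forces the quotient of
the horosphere to be compact and non-empty, so that (for `n ≥ 1`) there is a cusp at `y`. -/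
def IsCuspCrossSectionInClass {n : ℕ} (B : CompactFlatManifold n)
    (q : QuadraticForm ℚ (Fin (n + 2) → ℚ)) : Prop :=
  ∃ (M : ArithmeticHyperbolicManifold q) (y : Fin (n + 2) → ℝ),
    y ≠ 0 ∧ realBilin q y y = 0 ∧ Nonempty (B.Space ≃ₜ M.CrossSection y)

end

/-! Let `y` span the light-like line of the cusp. On `yᗮ / ℝ y` the form is positive definite, and
the horosphere is a copy of this Euclidean space. Both the horosphere and `ℝⁿ` are contractible, so
covering theory identifies the cusp group with `Γ` as an abstract group
(`nonempty_mulEquiv_cuspGroup`). Hence it maps to `(C_p)^k` with commutative kernel, of finite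
index. An element commuting with a finite-index subgroup has bounded displacement, so it acts
trivially on `yᗮ / ℝ y` (`isUnipotent_of_commute`). Integral elements of this kind make the line `ℝ
y` rational (`exists_rational_lightlike`), and their translation parts span enough for the whole
cusp group to act on a rational quadratic space `W` modelling `yᗮ / ℝ y` (`exists_rational_mulVec`).
The action on `W` is by commuting isometries with trivial `p`-th power.

A common fixed vector `v` would give a function `(v, ·)` on the horosphere that each group element
changes by a constant. These constants are periods, which vanish because `b₁ = 0`
(`period_eq_zero`). The function is then invariant, hence bounded by cocompactness, and this forces
`v = 0`.

What remains is algebra. If an isometry `g` of a rational form `b` satisfies `g ^ p = 1` and fixes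
no non-zero vector, its characteristic polynomial is `Φ_p ^ m`, so `det (g - g⁻¹) = p ^ m`. The form
`b(x, (g - g⁻¹) x')` is alternating, so its determinant is a square, and `b` has discriminant `p ^
m`. Splitting off fixed spaces extends this to commuting isometries. Since `W` is the complement of
a hyperbolic plane of determinant `-1`, it follows that `n = m (p - 1)` and `d(q) = -p ^ m`; the
parity of `m` separates the two cases. -/

/-! ### Gram determinants modulo squares -/

section AlternatingAndOrthogonalSums

open LinearMap (BilinForm)

variable {K V : Type*} [Field K] [AddCommGroup V] [Module K V]

/-- `d` is, up to a non-zero square, the determinant of a Gram matrix of `B`. -/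
def LinearMap.BilinForm.HasGramDet (B : BilinForm K V) (d : K) : Prop :=
  ∃ (m : ℕ) (b : Module.Basis (Fin m) K V) (r : K), r ≠ 0 ∧ (BilinForm.toMatrix b B).det = d * r ^ 2

namespace LinearMap.BilinForm

theorem exists_det_toMatrix_eq {ι κ : Type*} [Fintype ι] [DecidableEq ι] [Fintype κ]
    [DecidableEq κ] (B : BilinForm K V) (b : Module.Basis ι K V) (c : Module.Basis κ K V) :
    ∃ r : K, r ≠ 0 ∧ (BilinForm.toMatrix c B).det = (BilinForm.toMatrix b B).det * r ^ 2 := by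
  let e : κ ≃ ι := c.indexEquiv b
  let b' := b.reindex e.symm
  have hb' : (BilinForm.toMatrix b' B).det = (BilinForm.toMatrix b B).det := by
    rw [← Matrix.det_submatrix_equiv_self e.symm]
    congr 1
    ext i j
    simp [BilinForm.toMatrix_apply, b', Matrix.submatrix_apply]
  refine ⟨(b'.toMatrix c).det, ?_, ?_⟩
  · intro h
    have := congrArg Matrix.det (b'.toMatrix_mul_toMatrix_flip c)
    rw [Matrix.det_mul, h, zero_mul, Matrix.det_one] at this
    exact zero_ne_one this
  · rw [← BilinForm.toMatrix_mul_basis_toMatrix b' c B, Matrix.det_mul, Matrix.det_mul,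
      Matrix.det_transpose, hb']
    ring

theorem HasGramDet.of_basis {ι : Type*} [Fintype ι] [DecidableEq ι] {B : BilinForm K V}
    (b : Module.Basis ι K V) {d r : K} (hr : r ≠ 0) (h : (BilinForm.toMatrix b B).det = d * r ^ 2) :
    B.HasGramDet d := by
  obtain ⟨s, hs, h'⟩ := B.exists_det_toMatrix_eq b (b.reindex (Fintype.equivFin ι))
  exact ⟨_, _, r * s, mul_ne_zero hr hs, by rw [h', h]; ring⟩

theorem HasGramDet.det_toMatrix {ι : Type*} [Fintype ι] [DecidableEq ι] {B : BilinForm K V} {d : K}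
    (h : B.HasGramDet d) (b : Module.Basis ι K V) :
    ∃ r : K, r ≠ 0 ∧ (BilinForm.toMatrix b B).det = d * r ^ 2 := by
  obtain ⟨m, c, r, hr, hc⟩ := h
  obtain ⟨s, hs, h'⟩ := B.exists_det_toMatrix_eq c b
  exact ⟨r * s, mul_ne_zero hr hs, by rw [h', hc]; ring⟩

theorem HasGramDet.mul_of_isCompl {B : BilinForm K V} {U U' : Submodule K V} (hU : IsCompl U U')
    (h : ∀ u ∈ U, ∀ v ∈ U', B u v = 0) (h' : ∀ u ∈ U, ∀ v ∈ U', B v u = 0) {d d' : K}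
    (hd : (B.restrict U).HasGramDet d) (hd' : (B.restrict U').HasGramDet d') :
    B.HasGramDet (d * d') := by
  obtain ⟨m, b, r, hr, hb⟩ := hd
  obtain ⟨m', b', r', hr', hb'⟩ := hd'
  refine HasGramDet.of_basis ((b.prod b').map (U.prodEquivOfIsCompl U' hU)) (mul_ne_zero hr hr') ?_
  have : BilinForm.toMatrix ((b.prod b').map (U.prodEquivOfIsCompl U' hU)) B
      = Matrix.fromBlocks (BilinForm.toMatrix b (B.restrict U)) 0 0
        (BilinForm.toMatrix b' (B.restrict U')) := by
    ext (i | i) (j | j)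
    · simp [BilinForm.toMatrix_apply]
    · simpa [BilinForm.toMatrix_apply] using h _ (b i).2 _ (b' j).2
    · simpa [BilinForm.toMatrix_apply] using h' _ (b j).2 _ (b' i).2
    · simp [BilinForm.toMatrix_apply]
  rw [this, Matrix.det_fromBlocks_zero₂₁, hb, hb']
  ring

theorem hasGramDet_one_of_subsingleton [Subsingleton V] (B : BilinForm K V) : B.HasGramDet 1 :=
  ⟨0, Module.Basis.empty V, 1, one_ne_zero, by simp⟩

/-- A non-degenerate alternating form has a square determinant. -/
theorem IsAlt.hasGramDet_one [FiniteDimensional K V] {B : BilinForm K V} (hB : B.IsAlt)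
    (hB' : B.Nondegenerate) : B.HasGramDet 1 := by
  induction h : Module.finrank K V using Nat.strong_induction_on generalizing V with
  | _ d ih =>
    rcases subsingleton_or_nontrivial V with hV | hV
    · exact B.hasGramDet_one_of_subsingleton
    obtain ⟨u, hu⟩ := exists_ne (0 : V)
    obtain ⟨v, huv⟩ : ∃ v, B u v ≠ 0 := by
      by_contra! hc
      exact hu (hB'.1 u hc)
    have hvu : B v u = -B u v := by rw [← hB.neg_eq]
    have hlin : LinearIndependent K ![u, v] := by
      rw [LinearIndependent.pair_iff]
      intro s t hst
      have h1 : t * B u v = 0 := by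
        have := congrArg (B u) hst
        simpa [hB.self_eq_zero] using this
      have h2 : s * B v u = 0 := by
        have := congrArg (B v) hst
        simpa [hB.self_eq_zero] using this
      rw [hvu] at h2
      simp_all
    -- The plane spanned by `u` and `v` has Gram determinant `(B u v) ^ 2`; it splits off
    -- orthogonally and the induction continues on its complement.
    let U : Submodule K V := Submodule.span K (Set.range ![u, v])
    let b : Module.Basis (Fin 2) K U := Module.Basis.span hlin
    have hdet : (BilinForm.toMatrix b (B.restrict U)).det = 1 * (B u v) ^ 2 := by
      have hb0 : (b 0 : V) = u := congrArg Subtype.val (Module.Basis.span_apply hlin 0)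
      have hb1 : (b 1 : V) = v := congrArg Subtype.val (Module.Basis.span_apply hlin 1)
      rw [Matrix.det_fin_two]
      simp [BilinForm.toMatrix_apply, hb0, hb1, hB.self_eq_zero, hvu]
      ring
    have hUn : (B.restrict U).Nondegenerate := by
      apply BilinForm.nondegenerate_of_det_ne_zero _ b
      rw [hdet, one_mul]
      exact pow_ne_zero 2 huv
    have hc : IsCompl U (B.orthogonal U) :=
      B.isCompl_orthogonal_of_restrict_nondegenerate hB.isRefl hUn
    have hU2 : Module.finrank K U = 2 := by
      simpa using finrank_span_eq_card hlin
    have hlt : Module.finrank K (B.orthogonal U) < d := by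
      have := Submodule.finrank_add_eq_of_isCompl hc
      omega
    have hn : (B.restrict (B.orthogonal U)).Nondegenerate := by
      apply B.nondegenerate_restrict_of_disjoint_orthogonal hB.isRefl
      rw [B.orthogonal_orthogonal hB' hB.isRefl]
      exact hc.disjoint.symm
    have h1 := ih _ hlt (V := B.orthogonal U) (B := B.restrict (B.orthogonal U))
      (fun x => hB x) hn rfl
    have := HasGramDet.mul_of_isCompl hc (fun x hx y hy => hy x hx)
      (fun x hx y hy => hB.isRefl _ _ (hy x hx)) (HasGramDet.of_basis b huv hdet) h1
    simpa using this

end LinearMap.BilinForm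

end AlternatingAndOrthogonalSums

/-! ### Characteristic polynomials of endomorphisms of prime order -/

section CyclotomicCharpoly

open Polynomial

/-- A complex root of an irreducible factor of the characteristic polynomial is an eigenvalue, hence
a root of `f` by spectral mapping. So `f` is its minimal polynomial and divides the factor. -/
theorem Matrix.charpoly_eq_pow_of_irreducible {m : ℕ} (M : Matrix (Fin m) (Fin m) ℚ) {f : ℚ[X]}
    (hf : Irreducible f) (hfm : f.Monic) (hM : aeval M f = 0) : ∃ k, M.charpoly = f ^ k := by
  have key (g : ℚ[X]) (hg : Irreducible g) (hdvd : g ∣ M.charpoly) : f ∣ g := by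
    obtain ⟨z, hz⟩ : ∃ z : ℂ, aeval z g = 0 :=
      IsAlgClosed.exists_aeval_eq_zero ℂ g (degree_pos_of_irreducible hg).ne'
    let N : Matrix (Fin m) (Fin m) ℂ := M.map (algebraMap ℚ ℂ)
    have hz' : z ∈ spectrum ℂ N := by
      rw [Matrix.mem_spectrum_iff_isRoot_charpoly, Matrix.charpoly_map, IsRoot.def, eval_map_algebraMap]
      exact aeval_eq_zero_of_dvd_aeval_eq_zero hdvd hz
    have hN : aeval N (f.map (algebraMap ℚ ℂ)) = 0 := by
      have h1 : N = (algebraMap ℚ ℂ).mapMatrix M := rfl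
      rw [aeval_def, eval₂_map, h1]
      have h2 := Polynomial.hom_eval₂ f (algebraMap ℚ (Matrix (Fin m) (Fin m) ℚ))
        ((algebraMap ℚ ℂ).mapMatrix (m := Fin m)) M
      rw [← aeval_def, hM, map_zero] at h2
      rw [h2]
      congr 1
      exact RingHom.ext_rat _ _
    have hfz : aeval z f = 0 := by
      have h3 := spectrum.subset_polynomial_aeval N (f.map (algebraMap ℚ ℂ)) ⟨z, hz', rfl⟩
      rcases isEmpty_or_nonempty (Fin m) with hm | hm
      · have : Subsingleton (Matrix (Fin m) (Fin m) ℂ) := inferInstance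
        rw [spectrum.of_subsingleton] at hz'
        exact hz'.elim
      · rw [hN, spectrum.zero_eq] at h3
        simpa using h3
    rw [minpoly.eq_of_irreducible_of_monic hf hfz hfm]
    exact minpoly.dvd ℚ z hz
  have hne : M.charpoly ≠ 0 := M.charpoly_monic.ne_zero
  obtain ⟨k, r, hr, hk⟩ := WfDvdMonoid.max_power_factor hne hf
  refine ⟨k, ?_⟩
  have hu : IsUnit r := by
    by_contra hru
    obtain ⟨g, hg, hgr⟩ := WfDvdMonoid.exists_irreducible_factor hru
      (by rintro rfl; simp at hk; exact hne hk)
    exact hr ((key g hg (hgr.trans (hk ▸ dvd_mul_left r _))).trans hgr)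
  have hmon : r.Monic := by
    have := M.charpoly_monic
    rw [hk] at this
    exact (hfm.pow k).of_mul_monic_left this
  rw [hk, hmon.eq_one_of_isUnit hu, mul_one]

variable {V : Type*} [AddCommGroup V] [Module ℚ V] [FiniteDimensional ℚ V]

/-- From `(g - 1) Φ_p(g) = g ^ p - 1 = 0`, the image of `Φ_p(g)` consists of fixed vectors, so
`Φ_p(g) = 0`. -/
theorem LinearMap.charpoly_eq_cyclotomic_pow {p : ℕ} (hp : p.Prime) (g : V →ₗ[ℚ] V)
    (hg : g ^ p = 1) (hfix : ∀ v, g v = v → v = 0) : ∃ m, g.charpoly = cyclotomic p ℚ ^ m := by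
  have h0 : aeval g (cyclotomic p ℚ) = 0 := by
    have : Fact p.Prime := ⟨hp⟩
    have h1 := congrArg (aeval g) (cyclotomic_prime_mul_X_sub_one ℚ p)
    rw [mul_comm, map_mul] at h1
    ext v
    have h2 := LinearMap.congr_fun h1 v
    simp only [map_sub, aeval_X, map_one, map_pow, hg, sub_self, LinearMap.zero_apply] at h2
    exact hfix _ (sub_eq_zero.mp h2)
  let b := Module.finBasis ℚ V
  obtain ⟨m, hm⟩ := Matrix.charpoly_eq_pow_of_irreducible (LinearMap.toMatrix b b g)
    (cyclotomic.irreducible_rat hp.pos) (cyclotomic.monic p ℚ) (by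
      have := congrArg (LinearMap.toMatrixAlgEquiv b) h0
      rw [map_zero, ← AlgEquiv.coe_toAlgHom, ← Polynomial.aeval_algHom_apply] at this
      exact this)
  exact ⟨m, by rw [← hm, LinearMap.charpoly_toMatrix]⟩

/-- Here `g ^ (p - 1)` is `g⁻¹`, and `(g - g⁻¹) g = (1 - g)(-1 - g)`. The determinants on the right
are values of the characteristic polynomial, given by `Φ_p(1) = p` and `Φ_p(-1) = 1`; the latter and
`det g = 1` use that `p` is odd. -/
theorem LinearMap.det_sub_inv_of_pow_prime {p : ℕ} (hp : p.Prime) (hodd : Odd p) (g : V →ₗ[ℚ] V)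
    (hg : g ^ p = 1) (hfix : ∀ v, g v = v → v = 0) :
    ∃ m, Module.finrank ℚ V = m * (p - 1) ∧ LinearMap.det (g - g ^ (p - 1)) = (p : ℚ) ^ m := by
  have : Fact p.Prime := ⟨hp⟩
  obtain ⟨m, hm⟩ := g.charpoly_eq_cyclotomic_pow hp hg hfix
  refine ⟨m, ?_, ?_⟩
  · rw [← g.charpoly_natDegree, hm, natDegree_pow, natDegree_cyclotomic, Nat.totient_prime hp]
  have h1 : LinearMap.det (1 - g) = (p : ℚ) ^ m := by
    have := g.eval_charpoly 1
    rw [hm, eval_pow, eval_one_cyclotomic_prime] at this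
    rw [this, map_one]
  have h2 : LinearMap.det (-1 - g) = (1 : ℚ) := by
    have := g.eval_charpoly (-1)
    have hc := congrArg (eval (-1)) (cyclotomic_prime_mul_X_sub_one ℚ p)
    have hc' : eval (-1) (cyclotomic p ℚ) = 1 := by
      simp [hodd.neg_one_pow] at hc
      linarith
    rw [hm, eval_pow, hc', one_pow] at this
    rw [this, map_neg, map_one]
  have h3 : LinearMap.det g = 1 := by
    have := congrArg LinearMap.det hg
    rw [map_pow, map_one] at this
    exact hodd.strictMono_pow.injective (by simpa using this)
  have h4 : (g - g ^ (p - 1)) * g = (1 - g) * (-1 - g) := by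
    rw [sub_mul, ← pow_succ, Nat.sub_add_cancel hp.one_le, hg]
    noncomm_ring
  have := congrArg LinearMap.det h4
  rw [map_mul, map_mul, h1, h2, h3, mul_one, mul_one] at this
  exact this

end CyclotomicCharpoly

/-! ### Rational isometries of odd prime order -/

section Isometries

open LinearMap (BilinForm)

variable {V : Type*} [AddCommGroup V] [Module ℚ V] [FiniteDimensional ℚ V]

/-- Invariance and symmetry give `B(x, g⁻¹ x) = B(x, g x)`, so twisting `B` by `g - g⁻¹` yields an
alternating form. Its determinant is a square and equals `det B * p ^ m`. -/
theorem LinearMap.BilinForm.hasGramDet_of_isometry_of_pow_prime {p : ℕ} (hp : p.Prime)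
    (hodd : Odd p) {B : BilinForm ℚ V} (hs : B.IsSymm) (hn : B.Nondegenerate) (g : V →ₗ[ℚ] V)
    (hg : g ^ p = 1) (hfix : ∀ v, g v = v → v = 0) (hiso : ∀ v w, B (g v) (g w) = B v w) :
    ∃ m, Module.finrank ℚ V = m * (p - 1) ∧ B.HasGramDet ((p : ℚ) ^ m) := by
  obtain ⟨m, hm, hdet⟩ := g.det_sub_inv_of_pow_prime hp hodd hg hfix
  refine ⟨m, hm, ?_⟩
  have hp0 : (p : ℚ) ^ m ≠ 0 := pow_ne_zero _ (Nat.cast_ne_zero.mpr hp.ne_zero)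
  let S : V →ₗ[ℚ] V := g - g ^ (p - 1)
  have hgg (v : V) : g ((g ^ (p - 1)) v) = v := by
    rw [← Module.End.mul_apply, ← pow_succ', Nat.sub_add_cancel hp.one_le, hg]
    rfl
  have halt : (B.compRight S).IsAlt := by
    intro x
    have h1 : B x ((g ^ (p - 1)) x) = B x (g x) := by
      rw [← hiso, hgg, hs.eq]
    simp [S, h1]
  let b := Module.finBasis ℚ V
  have hdetS : (LinearMap.toMatrix b b S).det = (p : ℚ) ^ m := by
    rw [LinearMap.det_toMatrix, hdet]
  have hmat : (BilinForm.toMatrix b (B.compRight S)).det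
      = (BilinForm.toMatrix b B).det * (p : ℚ) ^ m := by
    rw [BilinForm.toMatrix_compRight, Matrix.det_mul, hdetS]
  have hnd : (B.compRight S).Nondegenerate := by
    apply BilinForm.nondegenerate_of_det_ne_zero _ b
    rw [hmat]
    exact mul_ne_zero ((BilinForm.nondegenerate_iff_det_ne_zero b).mp hn) hp0
  obtain ⟨r, hr, h⟩ := (halt.hasGramDet_one hnd).det_toMatrix b
  refine HasGramDet.of_basis b (r := r / (p : ℚ) ^ m) (div_ne_zero hr hp0) ?_
  rw [hmat, one_mul] at h
  field_simp
  exact h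

/-- A finite-dimensional rational quadratic space with commuting isometries of odd prime order `p`
without a common fixed vector: its dimension is `m (p - 1)` and its discriminant is `p ^ m`. -/
theorem LinearMap.BilinForm.hasGramDet_of_commuting_isometries {p : ℕ} (hp : p.Prime)
    (hodd : Odd p) {B : BilinForm ℚ V} (hs : B.IsSymm) (hani : ∀ v, B v v = 0 → v = 0)
    (S : Set (V →ₗ[ℚ] V)) (hcomm : ∀ g ∈ S, ∀ h ∈ S, g * h = h * g) (hpow : ∀ g ∈ S, g ^ p = 1)
    (hiso : ∀ g ∈ S, ∀ v w, B (g v) (g w) = B v w) (hfix : ∀ v, (∀ g ∈ S, g v = v) → v = 0) :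
    ∃ m, Module.finrank ℚ V = m * (p - 1) ∧ B.HasGramDet ((p : ℚ) ^ m) := by
  induction h : Module.finrank ℚ V using Nat.strong_induction_on generalizing V with
  | _ d ih =>
    rcases subsingleton_or_nontrivial V with hV | hV
    · exact ⟨0, by simp [← h, Module.finrank_zero_of_subsingleton],
        by simpa using B.hasGramDet_one_of_subsingleton⟩
    obtain ⟨g, hgS, hg1⟩ : ∃ g ∈ S, g ≠ 1 := by
      by_contra! hc
      obtain ⟨v, hv⟩ := exists_ne (0 : V)
      exact hv (hfix v fun g hg => by rw [hc g hg]; rfl)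
    have hnd (W : Submodule ℚ V) : (B.restrict W).Nondegenerate :=
      ⟨fun x hx => Subtype.ext (hani _ (hx x)), fun x hx => Subtype.ext (hani _ (hx x))⟩
    -- The fixed space of `g` is proper and, by commutativity, stable under `S`, so the induction
    -- applies to it. On its orthogonal complement `g` alone has no non-zero fixed vector.
    let U : Submodule ℚ V := LinearMap.ker (g - 1)
    have hU (v : V) : v ∈ U ↔ g v = v := by simp [U, sub_eq_zero]
    have hc : IsCompl U (B.orthogonal U) :=
      B.isCompl_orthogonal_of_restrict_nondegenerate hs.isRefl (hnd U)
    have hsU (W : Submodule ℚ V) : (B.restrict W).IsSymm := ⟨fun x y => hs.eq x y⟩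
    have hmapsU (k : V →ₗ[ℚ] V) (hk : k ∈ S) (v : V) (hv : v ∈ U) : k v ∈ U := by
      rw [hU] at hv ⊢
      rw [← Module.End.mul_apply, hcomm g hgS k hk, Module.End.mul_apply, hv]
    have hmapsO (v : V) (hv : v ∈ B.orthogonal U) : g v ∈ B.orthogonal U := by
      intro u hu
      have h1 : B u v = 0 := hv u hu
      have h2 := hiso g hgS u v
      rw [(hU u).mp hu, h1] at h2
      exact h2
    have hrestr_pow (W : Submodule ℚ V) (k : V →ₗ[ℚ] V) (hk : ∀ v ∈ W, k v ∈ W) (hkp : k ^ p = 1) :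
        (k.restrict hk) ^ p = 1 := by
      rw [Module.End.pow_restrict]
      ext v
      simp [hkp]
    obtain ⟨m₁, hm₁, hd₁⟩ := ih (Module.finrank ℚ U) (by
        rw [← h]
        apply Submodule.finrank_lt
        intro htop
        apply hg1
        ext v
        exact (hU v).mp (htop ▸ Submodule.mem_top))
      (V := U) (B := B.restrict U) (hsU U) (fun v hv => Subtype.ext (hani _ hv))
      {k | ∃ k' : V →ₗ[ℚ] V, k' ∈ S ∧ ∀ v : U, (k v : V) = k' v}
      (by
        rintro k ⟨k', hk', hk⟩ l ⟨l', hl', hl⟩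
        ext v
        simp only [Module.End.mul_apply, hk, hl]
        rw [← Module.End.mul_apply, hcomm k' hk' l' hl', Module.End.mul_apply])
      (by
        rintro k ⟨k', hk', hk⟩
        have : k = k'.restrict (hmapsU k' hk') := by ext v; exact hk v
        rw [this]
        exact hrestr_pow U k' _ (hpow k' hk'))
      (by
        rintro k ⟨k', hk', hk⟩ v w
        simp [hk, hiso k' hk'])
      (by
        intro v hv
        refine Subtype.ext (hfix v fun k hk => ?_)
        have := hv (k.restrict (hmapsU k hk)) ⟨k, hk, fun _ => rfl⟩
        exact congrArg Subtype.val this)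
      rfl
    obtain ⟨m₂, hm₂, hd₂⟩ := hasGramDet_of_isometry_of_pow_prime hp hodd (hsU (B.orthogonal U))
      (hnd _) (g.restrict hmapsO) (hrestr_pow _ g hmapsO (hpow g hgS))
      (fun v hv => by
        have h1 : (v : V) ∈ U := (hU _).mpr (congrArg Subtype.val hv)
        exact Subtype.ext (Submodule.disjoint_def.mp hc.disjoint _ h1 v.2))
      (fun v w => hiso g hgS v w)
    refine ⟨m₁ + m₂, ?_, ?_⟩
    · rw [← h, ← Submodule.finrank_add_eq_of_isCompl hc, hm₁, hm₂, add_mul]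
    · rw [pow_add]
      exact HasGramDet.mul_of_isCompl hc (fun x hx y hy => hy x hx)
        (fun x hx y hy => hs.isRefl _ _ (hy x hx)) hd₁ hd₂

end Isometries

/-! ### First homology and periods -/

open CategoryTheory Limits Simplicial in
-- A cocycle factors through chains modulo boundaries and a loop is a cycle, so the value of one on
-- the other factors through `H₁ = 0`.
theorem SSet.cocycle_apply_eq_zero (X : SSet.{0}) (R T : ModuleCat.{0} ℚ)
    (hX : IsZero (X.homology R 1)) (c : X _⦋1⦌ → (R ⟶ T))
    (hc : ∀ s : X _⦋2⦌, c (X.δ 0 s) - c (X.δ 1 s) + c (X.δ 2 s) = 0)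
    (x : X _⦋1⦌) (hx : X.δ 0 x = X.δ 1 x) : c x = 0 := by
  let K := X.chainComplex R
  have hk : X.ιChainComplex x ≫ K.d 1 0 = 0 := by
    rw [SSet.ιChainComplex_d]
    simp [Fin.sum_univ_two, hx]
  let φ : K.X 1 ⟶ T := Cofan.IsColimit.desc (X.isColimitChainComplexXCofan R 1) c
  have hφ (z : X _⦋1⦌) : X.ιChainComplex z ≫ φ = c z :=
    Cofan.IsColimit.fac (X.isColimitChainComplexXCofan R 1) c z
  have hdφ : K.d 2 1 ≫ φ = 0 := by
    apply SSet.chainComplex_hom_ext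
    intro s
    rw [← Category.assoc, SSet.ιChainComplex_d]
    refine (congrArg (· ≫ φ) (Fin.sum_univ_three _)).trans ?_
    simp only [Preadditive.add_comp, Preadditive.zsmul_comp, hφ, comp_zero]
    rw [← hc s]
    simp [sub_eq_add_neg]
  have h1 : X.ιChainComplex x ≫ φ
      = K.liftCycles (X.ιChainComplex x) 0 (by simp) hk ≫ K.homologyπ 1 ≫ K.homologyι 1 ≫
        K.descOpcycles φ 2 (by simp) hdφ := by
    rw [K.homology_π_ι_assoc, K.liftCycles_i_assoc, K.p_descOpcycles]
  rw [← hφ, h1, hX.eq_zero_of_src (K.homologyι 1)]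
  simp

section Simplices

variable {X : TopCat.{0}}

open CategoryTheory Simplicial

/-- The continuous map underlying a singular simplex. -/
noncomputable def singularSimplexMap {m : ℕ} (s : (TopCat.toSSet.obj X) _⦋m⦌) :
    C(stdSimplex ℝ (Fin (m + 1)), X) :=
  TopCat.toSSetObjEquiv X (.op ⦋m⦌) s

theorem singularSimplexMap_δ_vertex {m : ℕ} (s : (TopCat.toSSet.obj X) _⦋m + 1⦌) (i : Fin (m + 2))
    (v : stdSimplex ℝ (Fin (m + 1))) :
    singularSimplexMap ((TopCat.toSSet.obj X).δ i s) v
      = singularSimplexMap s (stdSimplex.map (Fin.succAbove i) v) :=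
  rfl


theorem stdSimplex.contractibleSpace_fin (m : ℕ) : ContractibleSpace (stdSimplex ℝ (Fin (m + 1))) :=
  (convex_stdSimplex ℝ (Fin (m + 1))).contractibleSpace ⟨_, single_mem_stdSimplex ℝ 0⟩

variable {E G : Type*} [TopologicalSpace E] [Group G] [MulAction G E] {π : E → X}

theorem IsQuotientCoveringMap.exists_lift_simplex (hπ : IsQuotientCoveringMap π G) {m : ℕ}
    (s : C(stdSimplex ℝ (Fin (m + 1)), X)) : ∃ τ : C(stdSimplex ℝ (Fin (m + 1)), E), π ∘ τ = s := by
  have := stdSimplex.contractibleSpace_fin m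
  have := (convex_stdSimplex ℝ (Fin (m + 1))).locallyPathConnectedSpace
  let a : stdSimplex ℝ (Fin (m + 1)) := stdSimplex.vertex 0
  obtain ⟨e, he⟩ := hπ.surjective (s a)
  obtain ⟨τ, ⟨-, hτ⟩, -⟩ := hπ.isCoveringMap.existsUnique_continuousMap_lifts s a e he
  exact ⟨τ, hτ⟩

theorem IsQuotientCoveringMap.exists_smul_eq_of_lifts (hπ : IsQuotientCoveringMap π G)
    {A : Type*} [TopologicalSpace A] [PreconnectedSpace A] [Nonempty A] {τ τ' : C(A, E)}
    (h : π ∘ τ = π ∘ τ') : ∃ g : G, ∀ a, τ a = g • τ' a := by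
  have a : A := Classical.arbitrary A
  obtain ⟨g, hg⟩ := hπ.apply_eq_iff_mem_orbit.mp (congrFun h a)
  have := hπ.toContinuousConstSMul
  refine ⟨g, fun b => congrFun (hπ.isCoveringMap.eq_of_comp_eq τ.continuous
    (τ'.continuous.const_smul g) ?_ a hg.symm) b⟩
  rw [h]
  funext b
  exact (hπ.map_smul g).symm

/-- A function on the total space of a quotient covering whose base has trivial first rational
homology has trivial periods. -/
theorem IsQuotientCoveringMap.period_eq_zero (hπ : IsQuotientCoveringMap π G)
    [PathConnectedSpace E]
    (hX : Module.rank ℚ (((AlgebraicTopology.singularHomologyFunctor (ModuleCat.{0} ℚ) 1).obj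
      (ModuleCat.of ℚ ℚ)).obj X) = 0)
    (f : E → ℝ) (c : G → ℝ) (hf : ∀ g x, f (g • x) = f x + c g) (g : G) : c g = 0 := by
  classical
  have hzero : Limits.IsZero ((TopCat.toSSet.obj X).homology (ModuleCat.of ℚ ℚ) 1) := by
    have := rank_zero_iff.mp hX
    exact ModuleCat.isZero_of_subsingleton
      (((AlgebraicTopology.singularHomologyFunctor (ModuleCat.{0} ℚ) 1).obj
      (ModuleCat.of ℚ ℚ)).obj X)
  choose lift hlift using fun s : (TopCat.toSSet.obj X) _⦋1⦌ =>
    hπ.exists_lift_simplex (singularSimplexMap s)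
  let v (i : Fin 2) : stdSimplex ℝ (Fin 2) := stdSimplex.vertex i
  -- The change of `f` along a lift of the edge. Any two lifts differ by a group element, which adds
  -- the same constant at both ends, so the choice is immaterial.
  let d (s : (TopCat.toSSet.obj X) _⦋1⦌) : ℝ := f (lift s (v 1)) - f (lift s (v 0))
  have hd (s : (TopCat.toSSet.obj X) _⦋1⦌) (τ : C(stdSimplex ℝ (Fin 2), E))
      (hτ : π ∘ τ = singularSimplexMap s) : d s = f (τ (v 1)) - f (τ (v 0)) := by
    obtain ⟨g, hg⟩ := hπ.exists_smul_eq_of_lifts ((hlift s).trans hτ.symm)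
    simp [d, hg, hf]
  let T : ModuleCat.{0} ℚ := ModuleCat.of ℚ ℝ
  let φ (s : (TopCat.toSSet.obj X) _⦋1⦌) : ModuleCat.of ℚ ℚ ⟶ T :=
    ModuleCat.ofHom (LinearMap.toSpanSingleton ℚ ℝ (d s))
  have hcoc (s : (TopCat.toSSet.obj X) _⦋2⦌) :
      φ ((TopCat.toSSet.obj X).δ 0 s) - φ ((TopCat.toSSet.obj X).δ 1 s)
        + φ ((TopCat.toSSet.obj X).δ 2 s) = 0 := by
    obtain ⟨τ, hτ⟩ := hπ.exists_lift_simplex (singularSimplexMap s)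
    have key (i : Fin 3) : d ((TopCat.toSSet.obj X).δ i s)
        = f (τ (stdSimplex.vertex (i.succAbove 1))) - f (τ (stdSimplex.vertex (i.succAbove 0))) := by
      rw [hd _ (τ.comp ⟨_, stdSimplex.continuous_map i.succAbove⟩)]
      · simp [v]
      · funext a
        rw [singularSimplexMap_δ_vertex, ← hτ]
        rfl
    ext
    simp only [φ, ModuleCat.hom_add, ModuleCat.hom_sub, ModuleCat.hom_ofHom, key, LinearMap.add_apply,
      LinearMap.sub_apply, LinearMap.toSpanSingleton_apply, one_smul, ModuleCat.hom_zero,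
      LinearMap.zero_apply]
    change f (τ (stdSimplex.vertex 2)) - f (τ (stdSimplex.vertex 1))
      - (f (τ (stdSimplex.vertex 2)) - f (τ (stdSimplex.vertex 0)))
      + (f (τ (stdSimplex.vertex 1)) - f (τ (stdSimplex.vertex 0))) = 0
    ring
  obtain ⟨x₀⟩ : Nonempty E := inferInstance
  -- The projection of this path is a loop, on which the cocycle takes the value `c g`.
  let p : Path x₀ (g • x₀) := PathConnectedSpace.somePath _ _
  let τ : C(stdSimplex ℝ (Fin 2), E) :=
    p.toContinuousMap.comp ⟨_, stdSimplexHomeomorphUnitInterval.continuous⟩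
  let s : (TopCat.toSSet.obj X) _⦋1⦌ := (TopCat.toSSetObjEquiv X (.op ⦋1⦌)).symm
    ((⟨π, hπ.continuous⟩ : C(E, X)).comp τ)
  have hs : singularSimplexMap s = (⟨π, hπ.continuous⟩ : C(E, X)).comp τ :=
    Equiv.apply_symm_apply _ _
  have hτ1 : τ (v 1) = g • x₀ := p.target
  have hτ0 : τ (v 0) = x₀ := p.source
  have hloop : (TopCat.toSSet.obj X).δ 0 s = (TopCat.toSSet.obj X).δ 1 s := by
    apply (TopCat.toSSetObjEquiv X (.op ⦋0⦌)).injective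
    ext a
    change singularSimplexMap ((TopCat.toSSet.obj X).δ 0 s) a
      = singularSimplexMap ((TopCat.toSSet.obj X).δ 1 s) a
    have ha : a = stdSimplex.vertex 0 := Subsingleton.elim _ _
    rw [ha, singularSimplexMap_δ_vertex, singularSimplexMap_δ_vertex, hs, stdSimplex.map_vertex,
      stdSimplex.map_vertex]
    change π (τ (v 1)) = π (τ (v 0))
    rw [hτ1, hτ0, hπ.map_smul]
  have hfin := SSet.cocycle_apply_eq_zero _ _ T hzero φ hcoc s hloop
  have hfin' : d s = 0 := by
    have := congrArg (fun h : ModuleCat.of ℚ ℚ ⟶ T => h.hom (1 : ℚ)) hfin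
    simpa [φ] using this
  rw [hd s τ (by rw [hs]; rfl), hτ1, hτ0, hf] at hfin'
  simpa using hfin'

end Simplices

/-! ### The real form and the hyperboloid -/

section RealForm

variable {m : ℕ} (q : QuadraticForm ℚ (Fin m → ℚ))

/-- The real bilinear form of `q`. -/
noncomputable def realForm : LinearMap.BilinForm ℝ (Fin m → ℝ) := Matrix.toBilin' (gramMatrix q)

theorem realForm_apply (x y : Fin m → ℝ) : realForm q x y = realBilin q x y :=
  Matrix.toBilin'_apply' _ _ _

theorem gramMatrix_isSymm : (gramMatrix q).IsSymm := by
  have : q.toMatrix'.IsSymm := q.isSymm_toMatrix'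
  exact this.map _

theorem realForm_isSymm : (realForm q).IsSymm :=
  Matrix.isSymm_toBilin'_iff_isSymm.mpr (gramMatrix_isSymm q)

theorem realForm_comm (x y : Fin m → ℝ) : realForm q x y = realForm q y x :=
  (realForm_isSymm q).eq x y

theorem continuous_realForm {X : Type*} [TopologicalSpace X] {f g : X → Fin m → ℝ}
    (hf : Continuous f) (hg : Continuous g) : Continuous fun x => realForm q (f x) (g x) := by
  simp only [realForm_apply, realBilin]
  exact hf.dotProduct (continuous_const.matrix_mulVec hg)

theorem realForm_mulVec_mulVec (A : Matrix (Fin m) (Fin m) ℝ) (x y : Fin m → ℝ) :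
    realForm q (A *ᵥ x) (A *ᵥ y) = x ⬝ᵥ ((Aᵀ * gramMatrix q * A) *ᵥ y) := by
  rw [realForm_apply, realBilin, ← Matrix.mulVec_mulVec, ← Matrix.mulVec_mulVec,
    Matrix.dotProduct_mulVec x Aᵀ, Matrix.vecMul_transpose]

end RealForm

section Hyperboloid

variable {n : ℕ} {q : QuadraticForm ℚ (Fin (n + 2) → ℚ)} {A : GL (Fin (n + 2)) ℝ}

theorem realForm_mulVec_of_mem_OPlus {g : GL (Fin (n + 2)) ℝ} (hg : g ∈ OPlus q A)
    (x y : Fin (n + 2) → ℝ) : realForm q (g.val *ᵥ x) (g.val *ᵥ y) = realForm q x y := by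
  rw [realForm_mulVec_mulVec, hg.1, realForm_apply]
  rfl

theorem dotProduct_standardGram (x y : Fin (n + 2) → ℝ) :
    x ⬝ᵥ (standardGram n *ᵥ y)
      = ∑ i : Fin (n + 1), x i.castSucc * y i.castSucc - x (Fin.last _) * y (Fin.last _) := by
  simp only [standardGram, Matrix.mulVec_diagonal, dotProduct]
  rw [Fin.sum_univ_castSucc]
  simp [Fin.castSucc_ne_last, sub_eq_add_neg]

theorem IsModelMatrix.realForm_mulVec (hA : IsModelMatrix q A) (x y : Fin (n + 2) → ℝ) :
    realForm q (A.val *ᵥ x) (A.val *ᵥ y)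
      = ∑ i : Fin (n + 1), x i.castSucc * y i.castSucc - x (Fin.last _) * y (Fin.last _) := by
  rw [realForm_mulVec_mulVec, hA, dotProduct_standardGram]

theorem GL_mulVec_inv_mulVec {m : ℕ} (A : GL (Fin m) ℝ) (x : Fin m → ℝ) :
    A.val *ᵥ ((A⁻¹).val *ᵥ x) = x := by
  rw [Matrix.mulVec_mulVec, ← Units.val_mul, mul_inv_cancel, Units.val_one, Matrix.one_mulVec]

theorem GL_inv_mulVec_mulVec {m : ℕ} (A : GL (Fin m) ℝ) (x : Fin m → ℝ) :
    (A⁻¹).val *ᵥ (A.val *ᵥ x) = x := by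
  rw [Matrix.mulVec_mulVec, ← Units.val_mul, inv_mul_cancel, Units.val_one, Matrix.one_mulVec]

theorem IsModelMatrix.mem_hyperboloid_iff (hA : IsModelMatrix q A) (x : Fin (n + 2) → ℝ) :
    x ∈ hyperboloid A ↔ realForm q x x = -1 ∧ 0 < ((A⁻¹).val *ᵥ x) (Fin.last _) := by
  constructor
  · rintro ⟨z, ⟨hz, hz'⟩, rfl⟩
    simp only [GL_inv_mulVec_mulVec]
    rw [hA.realForm_mulVec, ← dotProduct_standardGram]
    exact ⟨hz, hz'⟩
  · rintro ⟨h, h'⟩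
    refine ⟨(A⁻¹).val *ᵥ x, ⟨?_, h'⟩, GL_mulVec_inv_mulVec A x⟩
    rw [dotProduct_standardGram, ← hA.realForm_mulVec, GL_mulVec_inv_mulVec]
    exact h

/-- The orthogonal complement of a time-like vector is positive definite. -/
theorem IsModelMatrix.pos_of_orthogonal (hA : IsModelMatrix q A) {x v : Fin (n + 2) → ℝ}
    (hx : realForm q x x = -1) (hv : realForm q v x = 0) (hv0 : v ≠ 0) : 0 < realForm q v v := by
  obtain ⟨x, rfl⟩ : ∃ z, x = A.val *ᵥ z := ⟨_, (GL_mulVec_inv_mulVec A x).symm⟩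
  obtain ⟨v, rfl⟩ : ∃ z, v = A.val *ᵥ z := ⟨_, (GL_mulVec_inv_mulVec A v).symm⟩
  rw [hA.realForm_mulVec] at *
  have hcs := Finset.sum_mul_sq_le_sq_mul_sq Finset.univ
    (fun i : Fin (n + 1) => v i.castSucc) (fun i => x i.castSucc)
  simp only [← sq] at *
  set X := ∑ i : Fin (n + 1), x i.castSucc ^ 2
  set W := ∑ i : Fin (n + 1), v i.castSucc ^ 2 with hW
  have hW0 : 0 ≤ W := Finset.sum_nonneg fun i _ => sq_nonneg _
  rw [sub_eq_zero.mp hv, show X = x (Fin.last _) ^ 2 - 1 by linarith] at hcs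
  by_contra! hc
  have hX0 : 0 ≤ x (Fin.last _) ^ 2 - 1 := by
    have : 0 ≤ X := Finset.sum_nonneg fun i _ => sq_nonneg _
    linarith
  -- With last coordinates `v`, `x`, Cauchy–Schwarz reads `v² x² ≤ W (x² - 1)`, and `W ≤ v²` is
  -- assumed for contradiction.
  have h1 : v (Fin.last _) ^ 2 ≤ 0 := by nlinarith [mul_le_mul_of_nonneg_right hc hX0]
  have h2 : v (Fin.last _) = 0 := by nlinarith
  have h3 : W = 0 := by rw [h2] at hc; nlinarith
  apply hv0
  have h4 : v = 0 := by
    funext i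
    induction i using Fin.lastCases with
    | last => exact h2
    | cast i =>
      have := (Finset.sum_eq_zero_iff_of_nonneg (fun i _ => sq_nonneg _)).mp h3 i (Finset.mem_univ _)
      exact pow_eq_zero_iff two_ne_zero |>.mp this
  rw [h4, Matrix.mulVec_zero]

/-- Cauchy–Schwarz on the other coordinates gives `1 + b² ≤ 2ab` for the last coordinates `a`, `b`
of the two vectors in the standard model. This lets a horosphere be cut out by two equations,
without the sheet condition. -/
theorem IsModelMatrix.timelike_sign (hA : IsModelMatrix q A) {x y : Fin (n + 2) → ℝ}
    (hx : realForm q x x = -1) (hy : realForm q y y = 0) (hxy : realForm q x y = -1) :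
    0 < ((A⁻¹).val *ᵥ x) (Fin.last _) * ((A⁻¹).val *ᵥ y) (Fin.last _) := by
  obtain ⟨x, rfl⟩ : ∃ z, x = A.val *ᵥ z := ⟨_, (GL_mulVec_inv_mulVec A x).symm⟩
  obtain ⟨y, rfl⟩ : ∃ z, y = A.val *ᵥ z := ⟨_, (GL_mulVec_inv_mulVec A y).symm⟩
  rw [hA.realForm_mulVec] at *
  simp only [GL_inv_mulVec_mulVec]
  have hcs := Finset.sum_mul_sq_le_sq_mul_sq Finset.univ
    (fun i : Fin (n + 1) => x i.castSucc) (fun i => y i.castSucc)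
  simp only [← sq] at *
  rw [sub_eq_iff_eq_add.mp hx, sub_eq_iff_eq_add.mp hy, sub_eq_iff_eq_add.mp hxy] at hcs
  nlinarith [sq_nonneg (y (Fin.last (n + 1)))]

theorem IsModelMatrix.mem_hyperboloid_of_lightlike (hA : IsModelMatrix q A)
    {x x₀ y : Fin (n + 2) → ℝ} (hx₀ : x₀ ∈ hyperboloid A) (hy : realForm q y y = 0)
    (hx₀y : realForm q x₀ y = -1) (hx : realForm q x x = -1) (hxy : realForm q x y = -1) :
    x ∈ hyperboloid A := by
  rw [hA.mem_hyperboloid_iff] at hx₀ ⊢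
  refine ⟨hx, ?_⟩
  have h1 := hA.timelike_sign hx₀.1 hy hx₀y
  have h2 := hA.timelike_sign hx hy hxy
  have h3 := (pos_iff_pos_of_mul_pos h1).mp hx₀.2
  exact (pos_iff_pos_of_mul_pos h2).mpr h3

/-- The form `v ↦ q(v) + 2 (v, x)²` is positive definite if `q(x) = -1`. -/
theorem IsModelMatrix.pos_add_sq (hA : IsModelMatrix q A) {x v : Fin (n + 2) → ℝ}
    (hx : realForm q x x = -1) (hv : v ≠ 0) : 0 < realForm q v v + 2 * realForm q v x ^ 2 := by
  set c := realForm q v x with hc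
  have h1 : realForm q (v + c • x) x = 0 := by simp [hx, hc]
  have h2 : realForm q (v + c • x) (v + c • x) = realForm q v v + c ^ 2 := by
    simp only [map_add, map_smul, LinearMap.add_apply, LinearMap.smul_apply, hx, smul_eq_mul,
      realForm_comm q x v, ← hc]
    ring
  by_cases h0 : v + c • x = 0
  · have hv' : v = -(c • x) := eq_neg_of_add_eq_zero_left h0
    rw [h0, map_zero] at h2
    have hc0 : c ≠ 0 := by
      intro h
      rw [h] at hv'
      simp at hv'
      exact hv hv'
    have := pow_pos (abs_pos.mpr hc0) 2
    rw [sq_abs] at this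
    linarith
  · have := hA.pos_of_orthogonal hx h1 h0
    nlinarith [sq_nonneg c]

end Hyperboloid

/-! ### Geometry of horospheres -/

namespace ArithmeticHyperbolicManifold

variable {n : ℕ} {q : QuadraticForm ℚ (Fin (n + 2) → ℚ)} (M : ArithmeticHyperbolicManifold q)
  {y : Fin (n + 2) → ℝ}

theorem mem_horosphere_iff {x₀ : Fin (n + 2) → ℝ} (hy : realForm q y y = 0)
    (hx₀ : x₀ ∈ M.horosphere y) (x : Fin (n + 2) → ℝ) :
    x ∈ M.horosphere y ↔ realForm q x x = -1 ∧ realForm q x y = -1 := by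
  obtain ⟨h, h'⟩ := hx₀
  rw [← realForm_apply] at h'
  constructor
  · rintro ⟨hx, hx'⟩
    exact ⟨((M.isModelMatrix.mem_hyperboloid_iff _).mp hx).1, by rw [realForm_apply, hx']⟩
  · rintro ⟨hx, hx'⟩
    exact ⟨M.isModelMatrix.mem_hyperboloid_of_lightlike h hy h' hx hx', by
      rw [← realForm_apply, hx']⟩

/-- The form is positive semidefinite on `yᗮ`, with radical `ℝ y`. -/
theorem nonneg_of_orthogonal {x₀ v : Fin (n + 2) → ℝ} (hy : realForm q y y = 0)
    (hx₀ : x₀ ∈ M.horosphere y) (hv : realForm q v y = 0) :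
    0 ≤ realForm q v v ∧ (realForm q v v = 0 → ∃ c : ℝ, v = c • y) := by
  obtain ⟨h, h'⟩ := (M.mem_horosphere_iff hy hx₀ x₀).mp hx₀
  -- Since `(y, x₀) = -1`, adding `a • y` makes `v` orthogonal to `x₀`, and it does not change
  -- `q(v)`.
  set a := realForm q v x₀ with ha
  have h1 : realForm q (v + a • y) x₀ = 0 := by
    simp [realForm_comm q y x₀, h', ← ha]
  have h2 : realForm q (v + a • y) (v + a • y) = realForm q v v := by
    simp [realForm_comm q y v, hv, hy]
  by_cases h0 : v + a • y = 0
  · refine ⟨by rw [← h2, h0]; simp, fun _ => ?_⟩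
    exact ⟨-a, by rw [neg_smul]; exact eq_neg_of_add_eq_zero_left h0⟩
  · have := M.isModelMatrix.pos_of_orthogonal h h1 h0
    rw [h2] at this
    exact ⟨this.le, fun h => absurd h this.ne'⟩

/-- The vectors orthogonal to two given ones. -/
noncomputable def _root_.orthogonalPair (q : QuadraticForm ℚ (Fin (n + 2) → ℚ))
    (x y : Fin (n + 2) → ℝ) : Submodule ℝ (Fin (n + 2) → ℝ) :=
  LinearMap.ker (realForm q x) ⊓ LinearMap.ker (realForm q y)

/-- Horospherical coordinates. -/
noncomputable def horosphereHomeomorph {x₀ : Fin (n + 2) → ℝ} (hy : realForm q y y = 0)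
    (hx₀ : x₀ ∈ M.horosphere y) : orthogonalPair q x₀ y ≃ₜ M.horosphere y where
  -- For `x = x₀ + v + t y` one has `q(x) = -1 + q(v) - 2t`, which forces `t = q(v) / 2`.
  toFun v := ⟨x₀ + v.1 + (realForm q v v / 2) • y, by
    obtain ⟨h, h'⟩ := (M.mem_horosphere_iff hy hx₀ x₀).mp hx₀
    obtain ⟨v, hv1, hv2⟩ := v
    simp only [SetLike.mem_coe, LinearMap.mem_ker] at hv1 hv2
    have hv1' := realForm_comm q v x₀ ▸ hv1
    have hv2' := realForm_comm q v y ▸ hv2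
    rw [M.mem_horosphere_iff hy hx₀]
    constructor
    · simp [h, h', hv1, hv2, realForm_comm q v x₀, realForm_comm q v y, realForm_comm q y x₀, hy]
      ring
    · simp [h', hv2, realForm_comm q v y, hy]⟩
  invFun x := ⟨x.1 - x₀ + (realForm q x.1 x₀ + 1) • y, by
    obtain ⟨h, h'⟩ := (M.mem_horosphere_iff hy hx₀ x₀).mp hx₀
    obtain ⟨x, hx⟩ := x
    obtain ⟨k, k'⟩ := (M.mem_horosphere_iff hy hx₀ x).mp hx
    constructor
    · simp [h, h', realForm_comm q x₀ x]
    · simp [h', k', hy, realForm_comm q y x₀, realForm_comm q y x]⟩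
  left_inv v := by
    obtain ⟨h, h'⟩ := (M.mem_horosphere_iff hy hx₀ x₀).mp hx₀
    obtain ⟨v, hv1, hv2⟩ := v
    simp only [SetLike.mem_coe, LinearMap.mem_ker] at hv1 hv2
    ext1
    simp only [map_add, map_smul, LinearMap.add_apply, LinearMap.smul_apply, h,
      realForm_comm q v x₀, hv1, realForm_comm q y x₀, h', smul_eq_mul]
    module
  right_inv x := by
    obtain ⟨h, h'⟩ := (M.mem_horosphere_iff hy hx₀ x₀).mp hx₀
    obtain ⟨x, hx⟩ := x
    obtain ⟨k, k'⟩ := (M.mem_horosphere_iff hy hx₀ x).mp hx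
    ext1
    simp only [map_add, map_sub, map_smul, LinearMap.add_apply, LinearMap.sub_apply,
      LinearMap.smul_apply, h, k, k', realForm_comm q x₀ x, realForm_comm q y x₀,
      realForm_comm q y x, h', smul_eq_mul, hy]
    module
  continuous_toFun := by
    refine Continuous.subtype_mk ?_ _
    refine (continuous_const.add continuous_subtype_val).add (Continuous.fun_smul ?_ continuous_const)
    exact (continuous_realForm q continuous_subtype_val continuous_subtype_val).div_const _
  continuous_invFun := by
    refine Continuous.subtype_mk ?_ _
    refine (continuous_subtype_val.sub continuous_const).add (Continuous.fun_smul ?_ continuous_const)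
    exact (continuous_realForm q continuous_subtype_val continuous_const).add continuous_const

theorem contractibleSpace_horosphere {x₀ : Fin (n + 2) → ℝ} (hy : realForm q y y = 0)
    (hx₀ : x₀ ∈ M.horosphere y) : ContractibleSpace (M.horosphere y) :=
  (M.horosphereHomeomorph hy hx₀).symm.contractibleSpace

theorem locallyCompactSpace_horosphere {x₀ : Fin (n + 2) → ℝ} (hy : realForm q y y = 0)
    (hx₀ : x₀ ∈ M.horosphere y) : LocallyCompactSpace (M.horosphere y) :=
  have : FiniteDimensional ℝ (orthogonalPair q x₀ y) := inferInstance
  have : ProperSpace (orthogonalPair q x₀ y) := FiniteDimensional.proper ℝ _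
  (M.horosphereHomeomorph hy hx₀).symm.isClosedEmbedding.locallyCompactSpace

/-- A linear function that is bounded on a horosphere is trivial on it. -/
theorem exists_eq_smul_of_bounded {x₀ w : Fin (n + 2) → ℝ} (hy : realForm q y y = 0)
    (hx₀ : x₀ ∈ M.horosphere y) (hw : realForm q w y = 0) {C : ℝ}
    (hC : ∀ x ∈ M.horosphere y, |realForm q w x| ≤ C) : ∃ c : ℝ, w = c • y := by
  obtain ⟨h, h'⟩ := (M.mem_horosphere_iff hy hx₀ x₀).mp hx₀
  apply (M.nonneg_of_orthogonal hy hx₀ hw).2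
  set a := realForm q w x₀ with ha
  by_contra hne
  set N := realForm q w w with hN
  -- Moving from `x₀` in the direction of `w` changes the linear function at rate `N = q(w)`.
  have hb (t : ℝ) : |a + t * N| ≤ C := by
    let v : orthogonalPair q x₀ y := ⟨t • (w + a • y), by
      constructor
      · simp [realForm_comm q x₀ w, ← ha, h']
      · simp [realForm_comm q y w, hw, hy]⟩
    have : |realForm q w (x₀ + v.1 + (realForm q v v / 2) • y)| ≤ C :=
      hC _ (M.horosphereHomeomorph hy hx₀ v).2
    simpa [v, hw, ← ha, ← hN] using this
  have h1 := hb ((C + 1 - a) / N)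
  rw [div_mul_cancel₀ _ hne] at h1
  have := le_abs_self (a + (C + 1 - a))
  linarith

end ArithmeticHyperbolicManifold

/-! ### Bounded functions and the covering by the horosphere -/

/-- A continuous function that is invariant under a finite-index subgroup of a cocompact group is
bounded. -/
theorem exists_bound_of_finiteIndex_invariant {G X : Type*} [Group G] [TopologicalSpace X]
    [MulAction G X] [ContinuousConstSMul G X] [CompactSpace (MulAction.orbitRel.Quotient G X)]
    (T : Subgroup G) [T.FiniteIndex] {f : X → ℝ} (hf : Continuous f)
    (hT : ∀ t ∈ T, ∀ x, f (t • x) = f x) : ∃ C, ∀ x, |f x| ≤ C := by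
  have : Fintype (G ⧸ T) := T.fintypeQuotientOfFiniteIndex
  have hab (a b : G) (h : (a : G ⧸ T) = b) (x : X) : f (a⁻¹ • x) = f (b⁻¹ • x) := by
    have := hT _ (QuotientGroup.eq.mp h) (b⁻¹ • x)
    rw [← this, smul_smul]
    simp
  -- Summing over the cosets makes the function invariant under all of `G`; it descends to the
  -- compact quotient and dominates `|f|` through the trivial coset.
  let F (x : X) : ℝ := ∑ c : G ⧸ T, |f (c.out⁻¹ • x)|
  have hF : Continuous F := continuous_finsetSum _ fun c _ =>
    (hf.comp (continuous_const_smul c.out⁻¹)).abs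
  have hinv (g : G) (x : X) : F (g • x) = F x := by
    change ∑ c : G ⧸ T, |f (c.out⁻¹ • g • x)| = ∑ c : G ⧸ T, |f (c.out⁻¹ • x)|
    rw [← Equiv.sum_comp (MulAction.toPerm g⁻¹ : Equiv.Perm (G ⧸ T))
      fun c : G ⧸ T => |f (c.out⁻¹ • x)|]
    refine Finset.sum_congr rfl fun c _ => ?_
    have h : ((g⁻¹ * c.out : G) : G ⧸ T) = (((g⁻¹ • c).out : G) : G ⧸ T) := by
      rw [QuotientGroup.out_eq']
      conv_rhs => rw [← QuotientGroup.out_eq' c]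
      rfl
    have h' := hab _ _ h x
    rw [MulAction.toPerm_apply, ← h', smul_smul]
    simp
  let F' : MulAction.orbitRel.Quotient G X → ℝ := Quotient.lift F (by
    rintro a b ⟨g, rfl⟩
    exact hinv g b)
  have hF' : Continuous F' := continuous_quot_lift _ hF
  obtain ⟨C, hC⟩ := (isCompact_range hF').bddAbove
  refine ⟨C, fun x => ?_⟩
  calc |f x| = |f (((1 : G) : G ⧸ T).out⁻¹ • x)| := by
        have := hab 1 ((1 : G) : G ⧸ T).out (by rw [QuotientGroup.out_eq']) x
        rw [← this]
        simp
    _ ≤ F x := Finset.single_le_sum (f := fun c : G ⧸ T => |f (c.out⁻¹ • x)|)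
        (fun c _ => abs_nonneg _) (Finset.mem_univ _)
    _ ≤ C := hC ⟨Quotient.mk _ x, rfl⟩

theorem finite_integer_matrices_bounded {m : ℕ} (C : ℝ) :
    {g : GL (Fin m) ℝ | g ∈ (Matrix.GeneralLinearGroup.map (n := Fin m) (Int.castRingHom ℝ)).range ∧
      ∀ i j, |g.val i j| ≤ C}.Finite := by
  let N : ℤ := ⌈C⌉
  have h : (Set.pi Set.univ fun _ : Fin m => Set.pi Set.univ fun _ : Fin m =>
      Set.Icc (-N) N).Finite := Set.Finite.pi fun _ => Set.Finite.pi fun _ => Set.finite_Icc _ _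
  refine Set.Finite.of_finite_image (f := fun g : GL (Fin m) ℝ => g.val) ?_
    (fun a _ b _ h => Units.ext h)
  refine (h.image fun Z => (Matrix.of Z).map (fun z : ℤ => (z : ℝ))).subset ?_
  rintro _ ⟨g, ⟨⟨z, rfl⟩, hg⟩, rfl⟩
  refine ⟨z.val, ?_, rfl⟩
  intro i _ j _
  have h1 : |((z.val i j : ℤ) : ℝ)| ≤ C := hg i j
  have h2 : ((|z.val i j| : ℤ) : ℝ) ≤ N := by
    push_cast
    exact h1.trans (Int.le_ceil C)
  exact abs_le.mp (Int.cast_le.mp h2)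

namespace ArithmeticHyperbolicManifold

variable {n : ℕ} {q : QuadraticForm ℚ (Fin (n + 2) → ℚ)} (M : ArithmeticHyperbolicManifold q)
  {y : Fin (n + 2) → ℝ}

instance continuousConstSMul_horosphere :
    ContinuousConstSMul (M.cuspGroup y) (M.horosphere y) :=
  ⟨fun _ => Continuous.subtype_mk (continuous_const.matrix_mulVec continuous_subtype_val) _⟩

theorem coe_smul_horosphere (g : M.cuspGroup y) (x : M.horosphere y) :
    ((g • x : M.horosphere y) : Fin (n + 2) → ℝ) = g.1.val *ᵥ x.1 := rfl

theorem cuspGroup_mulVec (g : M.cuspGroup y) : g.1.val *ᵥ y = y := g.2.2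

theorem cuspGroup_isometry (g : M.cuspGroup y) (v w : Fin (n + 2) → ℝ) :
    realForm q (g.1.val *ᵥ v) (g.1.val *ᵥ w) = realForm q v w :=
  realForm_mulVec_of_mem_OPlus (M.le_OPlus g.2.1) v w

/-- The form `v ↦ q(v) + 2 (v, x)²` is positive definite for `x` on the horosphere, and is preserved
when `g` moves both `x` and `v`. By compactness it is bounded above on unit vectors over `K` and
below over `L`. -/
theorem exists_entry_bound {K L : Set (M.horosphere y)} (hy : realForm q y y = 0)
    (hK : IsCompact K) (hL : IsCompact L) :
    ∃ C : ℝ, ∀ g : M.cuspGroup y, ((g • ·) '' K ∩ L).Nonempty → ∀ i j, |g.1.val i j| ≤ C := by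
  let D (z : (Fin (n + 2) → ℝ) × (Fin (n + 2) → ℝ)) : ℝ :=
    realForm q z.2 z.2 + 2 * realForm q z.2 z.1 ^ 2
  have hD : Continuous D := (continuous_realForm q continuous_snd continuous_snd).add
    (((continuous_realForm q continuous_snd continuous_fst).pow 2).const_mul 2)
  have hDg (g : M.cuspGroup y) (x v : Fin (n + 2) → ℝ) :
      D (g.1.val *ᵥ x, g.1.val *ᵥ v) = D (x, v) := by
    simp only [D, M.cuspGroup_isometry]
  have hDs (t : ℝ) (x v : Fin (n + 2) → ℝ) : D (x, t • v) = t ^ 2 * D (x, v) := by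
    simp only [D, map_smul, LinearMap.smul_apply, smul_eq_mul]
    ring
  have hK' : IsCompact ((↑) '' K : Set (Fin (n + 2) → ℝ)) := hK.image continuous_subtype_val
  have hL' : IsCompact ((↑) '' L : Set (Fin (n + 2) → ℝ)) := hL.image continuous_subtype_val
  obtain ⟨c, hc, hcD⟩ : ∃ c > 0, ∀ z ∈ ((↑) '' L : Set (Fin (n + 2) → ℝ)) ×ˢ
      Metric.sphere (0 : Fin (n + 2) → ℝ) 1, c ≤ D z := by
    refine (hL'.prod (isCompact_sphere _ _)).exists_forall_le' hD.continuousOn ?_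
    rintro ⟨_, v⟩ ⟨⟨x, hx, rfl⟩, hv⟩
    refine M.isModelMatrix.pos_add_sq ((M.mem_horosphere_iff hy x.2 _).mp x.2).1 ?_
    rintro rfl
    simp at hv
  obtain ⟨C, hC⟩ := ((hK'.prod (isCompact_sphere (0 : Fin (n + 2) → ℝ) 1)).image hD).bddAbove
  -- The columns `u` satisfy `‖u‖² ≤ C / c`, and `‖u‖ ≤ ‖u‖² + 1`.
  refine ⟨C / c + 1, fun g hg i j => ?_⟩
  obtain ⟨_, ⟨x, hx, rfl⟩, hgx⟩ := hg
  let e : Fin (n + 2) → ℝ := Pi.single j 1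
  have he : e ∈ Metric.sphere (0 : Fin (n + 2) → ℝ) 1 := by simp [e, Pi.norm_single]
  have h1 : D (x.1, e) ≤ C := hC ⟨(x.1, e), ⟨⟨x, hx, rfl⟩, he⟩, rfl⟩
  set u := g.1.val *ᵥ e with hu
  have hij : g.1.val i j = u i := by simp [hu, e]
  have h2 : D (g.1.val *ᵥ x.1, u) ≤ C := by rwa [hDg]
  have hle : |u i| ≤ ‖u‖ := norm_le_pi_norm u i
  rw [hij]
  refine hle.trans ?_
  rcases eq_or_ne u 0 with h0 | h0
  · have hC0 : 0 ≤ C := by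
      rw [h0] at h2
      simpa [D] using h2
    rw [h0, norm_zero]
    positivity
  · have hn : 0 < ‖u‖ := norm_pos_iff.mpr h0
    have h3 := hcD (g.1.val *ᵥ x.1, ‖u‖⁻¹ • u) ⟨⟨_, hgx, rfl⟩, by
      simp [norm_smul, hn.ne']⟩
    rw [hDs] at h3
    have h4 : ‖u‖ ^ 2 * c ≤ C := by
      calc ‖u‖ ^ 2 * c ≤ ‖u‖ ^ 2 * (‖u‖⁻¹ ^ 2 * D (g.1.val *ᵥ x.1, u)) := by gcongr
        _ = D (g.1.val *ᵥ x.1, u) := by field_simp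
        _ ≤ C := h2
    have h5 : ‖u‖ ^ 2 ≤ C / c := by rwa [le_div_iff₀ hc]
    nlinarith [sq_nonneg (‖u‖ - 1)]

/-- The elements of the cusp group with integer entries. -/
noncomputable def cuspInt (y : Fin (n + 2) → ℝ) : Subgroup (M.cuspGroup y) :=
  (OPlusInt q M.A).subgroupOf (M.cuspGroup y)

instance finiteIndex_cuspInt : (M.cuspInt y).FiniteIndex := by
  have h : (OPlusInt q M.A).IsFiniteRelIndex M.Δ := ⟨M.commensurable.2⟩
  have hle : M.cuspGroup y ≤ M.Δ := fun g hg => hg.1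
  have : (OPlusInt q M.A).relIndex (M.cuspGroup y) ≠ 0 :=
    mt (Subgroup.relIndex_eq_zero_of_le_right hle) h.relIndex_ne_zero
  exact ⟨this⟩

/-- Only finitely many integral matrices have bounded entries; the property then passes from the
integral subgroup to the cusp group, in which it has finite index. -/
theorem properlyDiscontinuousSMul_horosphere (hy : realForm q y y = 0) :
    ProperlyDiscontinuousSMul (M.cuspGroup y) (M.horosphere y) := by
  have hZ : ProperlyDiscontinuousSMul (M.cuspInt y) (M.horosphere y) := by
    rw [Subgroup.properlyDiscontinuousSMul_iff]
    intro K L hK hL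
    obtain ⟨C, hC⟩ := M.exists_entry_bound hy hK hL
    refine Set.Finite.of_finite_image (f := Subtype.val) ?_ Subtype.val_injective.injOn
    refine (finite_integer_matrices_bounded C).subset ?_
    rintro _ ⟨g, ⟨hg, hg'⟩, rfl⟩
    exact ⟨hg.2, hC g hg'⟩
  have htop : ProperlyDiscontinuousSMul (⊤ : Subgroup (M.cuspGroup y)) (M.horosphere y) :=
    have : (M.cuspInt y).IsFiniteRelIndex ⊤ := ⟨by
      rw [Subgroup.relIndex_top_right]
      exact Subgroup.FiniteIndex.index_ne_zero⟩
    ProperlyDiscontinuousSMul.ofFiniteRelIndex ⊤ (M.cuspInt y)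
  rw [Subgroup.properlyDiscontinuousSMul_iff] at htop
  rw [properlyDiscontinuousSMul_iff]
  intro K L hK hL
  exact (htop hK hL).subset fun g hg => ⟨Subgroup.mem_top _, hg⟩

/-- Point stabilizers are finite by proper discontinuity, hence trivial as `Δ` is torsion-free. -/
theorem isCancelSMul_horosphere (hy : realForm q y y = 0) :
    IsCancelSMul (M.cuspGroup y) (M.horosphere y) := by
  have := M.properlyDiscontinuousSMul_horosphere hy
  rw [isCancelSMul_iff_eq_one_of_smul_eq]
  intro g x hgx
  have hfin := ProperlyDiscontinuousSMul.finite_stabilizer' (M.cuspGroup y) x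
  have hord : IsOfFinOrder g := by
    rw [isOfFinOrder_iff_zpow_eq_one]
    obtain ⟨a, -, b, -, hab, h⟩ := Set.infinite_univ.exists_ne_map_eq_of_mapsTo
      (f := fun k : ℤ => g ^ k) (t := {g : M.cuspGroup y | g • x = x})
      (fun k _ => zpow_mem (K := MulAction.stabilizer _ x) hgx k) hfin
    refine ⟨a - b, sub_ne_zero.mpr hab, ?_⟩
    rw [zpow_sub, show g ^ a = g ^ b from h, mul_inv_cancel]
  have := M.torsionFree g.1 g.2.1 ((M.cuspGroup y).subtype.isOfFinOrder hord)
  exact Subtype.ext this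

theorem isQuotientCoveringMap_horosphere {x₀ : Fin (n + 2) → ℝ} (hy : realForm q y y = 0)
    (hx₀ : x₀ ∈ M.horosphere y) :
    IsQuotientCoveringMap (Quotient.mk <| MulAction.orbitRel (M.cuspGroup y) (M.horosphere y))
      (M.cuspGroup y) :=
  have := M.properlyDiscontinuousSMul_horosphere hy
  have := M.isCancelSMul_horosphere hy
  have := M.locallyCompactSpace_horosphere hy hx₀
  isQuotientCoveringMap_quotientMk_of_properlyDiscontinuousSMul

end ArithmeticHyperbolicManifold

namespace CompactFlatManifold

variable {n : ℕ} (B : CompactFlatManifold n)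

theorem isQuotientCoveringMap :
    IsQuotientCoveringMap (Quotient.mk <| MulAction.orbitRel B.Γ (Euc n)) B.Γ :=
  have := B.properlyDiscontinuous
  have : ContinuousConstSMul B.Γ (Euc n) := ⟨fun g => g.1.continuous⟩
  have : IsCancelSMul B.Γ (Euc n) := by
    rw [isCancelSMul_iff_eq_one_of_smul_eq]
    intro g x hgx
    exact Subtype.ext (B.free g.1 g.2 x hgx)
  isQuotientCoveringMap_quotientMk_of_properlyDiscontinuousSMul

end CompactFlatManifold

theorem eq_zero_of_abs_quadratic_le {a b c C : ℝ} (h : ∀ s : ℝ, |a + s * b + s ^ 2 * c| ≤ C) :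
    c = 0 := by
  by_contra hc
  have hC : 0 ≤ C := (abs_nonneg _).trans (h 0)
  have hc' : 0 < |c| := abs_pos.mpr hc
  set s : ℝ := (C + |a| + 1) / |c| + 1 with hs
  have hs1 : 1 ≤ s := by
    have : 0 ≤ (C + |a| + 1) / |c| := by positivity
    linarith
  have hsc : C + |a| + 1 ≤ s * |c| := by
    rw [hs, add_mul, div_mul_cancel₀ _ hc'.ne']
    linarith
  -- Averaging the bounds at `s` and `-s` removes the linear term.
  have h1 : |a + s ^ 2 * c| ≤ C := by
    have h2 := h s
    have h3 := h (-s)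
    rw [abs_le] at *
    constructor <;> nlinarith
  have h4 : s ^ 2 * |c| ≤ C + |a| := by
    calc s ^ 2 * |c| = |(a + s ^ 2 * c) - a| := by
          rw [add_sub_cancel_left, abs_mul, abs_of_nonneg (sq_nonneg s)]
      _ ≤ |a + s ^ 2 * c| + |a| := abs_sub _ _
      _ ≤ C + |a| := by linarith
  have h5 : s * |c| ≤ s ^ 2 * |c| := by
    rw [sq, mul_assoc]
    exact le_mul_of_one_le_left (by positivity) hs1
  linarith

/-! ### Holonomy and translations -/

namespace CompactFlatManifold

variable {n : ℕ} (B : CompactFlatManifold n)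

theorem mul_comm_of_linearPart_eq_one {g h : Euc n ≃ᵃⁱ[ℝ] Euc n} (hg : linearPart n g = 1)
    (hh : linearPart n h = 1) : g * h = h * g := by
  have key (k : Euc n ≃ᵃⁱ[ℝ] Euc n) (hk : linearPart n k = 1) (x : Euc n) : k x = x + k 0 := by
    have h1 := k.map_vadd 0 x
    have h2 : k.linearIsometryEquiv x = x := congrArg (fun f : Euc n ≃ₗᵢ[ℝ] Euc n => f x) hk
    rw [h2] at h1
    simpa using h1
  ext1 x
  change g (h x) = h (g x)
  rw [key g hg, key h hh, key h hh (g x), key g hg x]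
  abel

/-- The holonomy homomorphism. -/
noncomputable def holonomyHom : B.Γ →* B.holonomyGroup := (linearPart n).subgroupMap B.Γ

theorem commute_of_holonomyHom_eq_one {g h : B.Γ} (hg : B.holonomyHom g = 1)
    (hh : B.holonomyHom h = 1) : g * h = h * g :=
  Subtype.ext (mul_comm_of_linearPart_eq_one (congrArg Subtype.val hg) (congrArg Subtype.val hh))

end CompactFlatManifold

/-! ### Unipotent elements of the cusp group -/

namespace ArithmeticHyperbolicManifold

variable {n : ℕ} {q : QuadraticForm ℚ (Fin (n + 2) → ℚ)} (M : ArithmeticHyperbolicManifold q)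
  {y : Fin (n + 2) → ℝ}

/-- Both groups are deck groups of simply connected coverings of the same space, so the opposite of
each is its fundamental group. -/
theorem nonempty_mulEquiv_cuspGroup {x₀ : Fin (n + 2) → ℝ} (hy : realForm q y y = 0)
    (hx₀ : x₀ ∈ M.horosphere y) (B : CompactFlatManifold n) (ψ : B.Space ≃ₜ M.CrossSection y) :
    Nonempty (M.cuspGroup y ≃* B.Γ) := by
  have := M.contractibleSpace_horosphere hy hx₀
  have h1 := B.isQuotientCoveringMap
  have h2 := (M.isQuotientCoveringMap_horosphere hy hx₀).homeomorph_comp ψ.symm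
  let e₁ : Euc n := 0
  obtain ⟨e₂, he₂⟩ := h2.surjective (Quotient.mk _ e₁)
  have i1 := h1.fundamentalGroupEquiv (x := Quotient.mk _ e₁) ⟨e₁, rfl⟩
  have i2 := h2.fundamentalGroupEquiv (x := Quotient.mk _ e₁) ⟨e₂, he₂⟩
  exact ⟨MulEquiv.op.symm (i2.symm.trans i1)⟩

/-- The homeomorphism need not respect any metric, so only this group-theoretic trace of the
holonomy is carried over: the kernel corresponds to the translations in `Γ`. -/
theorem exists_hom_with_commutative_ker {k p : ℕ} {x₀ : Fin (n + 2) → ℝ} (hy : realForm q y y = 0)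
    (hx₀ : x₀ ∈ M.horosphere y) (B : CompactFlatManifold n) (ψ : B.Space ≃ₜ M.CrossSection y)
    (hol : Nonempty (B.holonomyGroup ≃* Multiplicative (Fin k → ZMod p))) :
    ∃ F : M.cuspGroup y →* Multiplicative (Fin k → ZMod p),
      ∀ s t, F s = 1 → F t = 1 → s * t = t * s := by
  obtain ⟨e⟩ := M.nonempty_mulEquiv_cuspGroup hy hx₀ B ψ
  obtain ⟨f⟩ := hol
  refine ⟨(f.toMonoidHom.comp B.holonomyHom).comp e.toMonoidHom, fun s t hs ht => ?_⟩
  apply e.injective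
  rw [map_mul, map_mul]
  apply B.commute_of_holonomyHom_eq_one
  · exact f.injective (hs.trans (map_one f).symm)
  · exact f.injective (ht.trans (map_one f).symm)

/-- `g` acts trivially on `yᗮ / ℝ y`. -/
def IsUnipotent (g : M.cuspGroup y) : Prop :=
  ∀ v, realForm q v y = 0 → ∃ c : ℝ, g.1.val *ᵥ v = v + c • y

theorem realForm_mulVec_right {g : M.cuspGroup y} (v : Fin (n + 2) → ℝ) :
    realForm q (g.1.val *ᵥ v) y = realForm q v y := by
  have := M.cuspGroup_isometry g v y
  rwa [M.cuspGroup_mulVec] at this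

/-- An element of the cusp group that commutes with a finite-index subgroup has bounded
displacement, so it is unipotent. -/
theorem isUnipotent_of_commute [CompactSpace (M.CrossSection y)] {x₀ : Fin (n + 2) → ℝ}
    (hy : realForm q y y = 0) (hx₀ : x₀ ∈ M.horosphere y) (T : Subgroup (M.cuspGroup y))
    [T.FiniteIndex] {g : M.cuspGroup y} (hg : ∀ t ∈ T, g * t = t * g) : M.IsUnipotent g := by
  obtain ⟨C, hC⟩ := exists_bound_of_finiteIndex_invariant T
    (f := fun x : M.horosphere y => realForm q x.1 (g.1.val *ᵥ x.1))
    (continuous_realForm q continuous_subtype_val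
      (continuous_const.matrix_mulVec continuous_subtype_val)) (by
      intro t ht x
      have h1 : g.1.val *ᵥ (t.1.val *ᵥ x.1) = t.1.val *ᵥ (g.1.val *ᵥ x.1) := by
        have := congrArg (fun k : M.cuspGroup y => k.1.val *ᵥ x.1) (hg t ht)
        simpa [Matrix.mulVec_mulVec] using this
      simp only [M.coe_smul_horosphere, h1, M.cuspGroup_isometry])
  obtain ⟨h, h'⟩ := (M.mem_horosphere_iff hy hx₀ x₀).mp hx₀
  intro v hv
  suffices h0 : realForm q (g.1.val *ᵥ v - v) (g.1.val *ᵥ v - v) = 0 by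
    have h1 : realForm q (g.1.val *ᵥ v - v) y = 0 := by
      rw [map_sub, LinearMap.sub_apply, M.realForm_mulVec_right, sub_self]
    obtain ⟨c, hc⟩ := (M.nonneg_of_orthogonal hy hx₀ h1).2 h0
    exact ⟨c, by rw [← hc]; abel⟩
  set a := realForm q v x₀ with ha
  have hax : realForm q (v + a • y) x₀ = 0 := by simp [realForm_comm q y x₀, h', ← ha]
  have hay : realForm q (v + a • y) y = 0 := by simp [hv, hy]
  have hga : g.1.val *ᵥ v - v = g.1.val *ᵥ (v + a • y) - (v + a • y) := by
    rw [Matrix.mulVec_add, Matrix.mulVec_smul, M.cuspGroup_mulVec]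
    abel
  rw [hga]
  set u := v + a • y
  let d₀ := g.1.val *ᵥ x₀ - x₀
  let d := g.1.val *ᵥ u - u
  -- Along the horosphere points `x₀ + s u + r y`, the squared displacement `q(g x - x) = -2 - 2 (x,
  -- g x)` is a quadratic polynomial in `s` with leading coefficient `q(g u - u)`. It is bounded
  -- because `(x, g x)` is.
  apply eq_zero_of_abs_quadratic_le (a := realForm q d₀ d₀) (b := 2 * realForm q d₀ d)
    (C := 2 + 2 * C)
  intro s
  let x : M.horosphere y := M.horosphereHomeomorph hy hx₀ ⟨s • u, by
    constructor
    · simp [realForm_comm q x₀ u, hax]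
    · simp [realForm_comm q y u, hay]⟩
  have hx : ∃ r : ℝ, x.1 = x₀ + s • u + r • y := ⟨_, rfl⟩
  obtain ⟨r, hr⟩ := hx
  have hgx : g.1.val *ᵥ x.1 - x.1 = d₀ + s • d := by
    rw [hr]
    simp only [Matrix.mulVec_add, Matrix.mulVec_smul, M.cuspGroup_mulVec, d₀, d]
    module
  have h1 : realForm q (g.1.val *ᵥ x.1 - x.1) (g.1.val *ᵥ x.1 - x.1)
      = -2 - 2 * realForm q x.1 (g.1.val *ᵥ x.1) := by
    have hxx := ((M.mem_horosphere_iff hy hx₀ _).mp x.2).1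
    simp only [map_sub, LinearMap.sub_apply, M.cuspGroup_isometry,
      realForm_comm q (g.1.val *ᵥ x.1) x.1, hxx]
    ring
  have h2 : realForm q d₀ d₀ + s * (2 * realForm q d₀ d) + s ^ 2 * realForm q d d
      = -2 - 2 * realForm q x.1 (g.1.val *ᵥ x.1) := by
    rw [← h1, hgx]
    simp only [map_add, map_smul, LinearMap.add_apply, LinearMap.smul_apply, smul_eq_mul,
      realForm_comm q d d₀]
    ring
  change |realForm q d₀ d₀ + s * (2 * realForm q d₀ d) + s ^ 2 * realForm q d d| ≤ _
  rw [h2]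
  have := abs_le.mp (hC x)
  rw [abs_le]
  constructor <;> linarith

/-- The coefficient of `y` is forced by `(g v, g z) = (v, z)`; thus `g` acts on `yᗮ` through its
translation part `g z - z`. -/
theorem IsUnipotent.mulVec_eq {M : ArithmeticHyperbolicManifold q} {g : M.cuspGroup y}
    (hg : M.IsUnipotent g) {z v : Fin (n + 2) → ℝ}
    (hz : realForm q z y ≠ 0) (hv : realForm q v y = 0) :
    g.1.val *ᵥ v = v - (realForm q v (g.1.val *ᵥ z - z) / realForm q z y) • y := by
  obtain ⟨c, hc⟩ := hg v hv
  have h1 := M.cuspGroup_isometry g v z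
  have h2 : realForm q (g.1.val *ᵥ v) (g.1.val *ᵥ z)
      = realForm q v (g.1.val *ᵥ z) + c * realForm q z y := by
    rw [hc, map_add, LinearMap.add_apply, map_smul, LinearMap.smul_apply, smul_eq_mul,
      realForm_comm q y, M.realForm_mulVec_right]
  have h3 : realForm q v (g.1.val *ᵥ z - z) / realForm q z y = -c := by
    rw [div_eq_iff hz, map_sub]
    linarith
  rw [hc, h3, neg_smul, sub_neg_eq_add]

/-- The translation parts of a finite-index subgroup of unipotent elements span `yᗮ / ℝ y`. -/
theorem exists_eq_smul_of_orthogonal_translations [CompactSpace (M.CrossSection y)]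
    {x₀ : Fin (n + 2) → ℝ} (hy : realForm q y y = 0) (hx₀ : x₀ ∈ M.horosphere y)
    (T : Subgroup (M.cuspGroup y)) [T.FiniteIndex] (hT : ∀ t ∈ T, M.IsUnipotent t)
    {z w : Fin (n + 2) → ℝ} (hz : realForm q z y ≠ 0) (hw : realForm q w y = 0)
    (h : ∀ t ∈ T, realForm q w (t.1.val *ᵥ z - z) = 0) : ∃ c : ℝ, w = c • y := by
  obtain ⟨C, hC⟩ := exists_bound_of_finiteIndex_invariant T
    (f := fun x : M.horosphere y => realForm q w x.1)
    (continuous_realForm q continuous_const continuous_subtype_val) (by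
      intro t ht x
      have h1 : t.1.val *ᵥ w = w := by
        rw [(hT t ht).mulVec_eq hz hw, h t ht]
        simp
      rw [M.coe_smul_horosphere]
      conv_lhs => rw [← h1]
      exact M.cuspGroup_isometry t w x.1)
  exact M.exists_eq_smul_of_bounded hy hx₀ hw fun x hx => hC ⟨x, hx⟩

end ArithmeticHyperbolicManifold

/-! ### Rational structure of the cusp -/

section Rational

variable {m : ℕ} (q : QuadraticForm ℚ (Fin m → ℚ))

/-- The inclusion of rational vectors into real vectors. -/
def ratVec (m : ℕ) : (Fin m → ℚ) →ₗ[ℚ] (Fin m → ℝ) where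
  toFun v i := v i
  map_add' v w := by ext i; simp
  map_smul' a v := by ext i; simp [Rat.smul_def]

theorem ratVec_apply (v : Fin m → ℚ) (i : Fin m) : ratVec m v i = v i := rfl

theorem ratVec_smul (a : ℚ) (v : Fin m → ℚ) : ratVec m (a • v) = (a : ℝ) • ratVec m v := by
  ext i
  simp [ratVec_apply]

theorem ratVec_injective : Function.Injective (ratVec m) := fun v w h => by
  ext i
  exact Rat.cast_injective (congrFun h i)

/-- The rational bilinear form of `q`. -/
noncomputable def ratForm : LinearMap.BilinForm ℚ (Fin m → ℚ) := Matrix.toBilin' q.toMatrix'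

theorem realForm_ratVec (v w : Fin m → ℚ) :
    realForm q (ratVec m v) (ratVec m w) = (ratForm q v w : ℝ) := by
  simp [realForm, ratForm, Matrix.toBilin'_apply, gramMatrix, ratVec_apply]

theorem ratForm_isSymm : (ratForm q).IsSymm :=
  Matrix.isSymm_toBilin'_iff_isSymm.mpr q.isSymm_toMatrix'

theorem ratForm_comm (v w : Fin m → ℚ) : ratForm q v w = ratForm q w v := (ratForm_isSymm q).eq v w

theorem ratVec_mulVec (Z : Matrix (Fin m) (Fin m) ℚ) (v : Fin m → ℚ) :
    (Z.map fun a : ℚ => (a : ℝ)) *ᵥ ratVec m v = ratVec m (Z *ᵥ v) := by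
  ext i
  simp [Matrix.mulVec, dotProduct, ratVec_apply]

end Rational

theorem IsModelMatrix.ratForm_nondegenerate {n : ℕ} {q : QuadraticForm ℚ (Fin (n + 2) → ℚ)}
    {A : GL (Fin (n + 2)) ℝ} (hA : IsModelMatrix q A) : (ratForm q).Nondegenerate := by
  have h1 : (gramMatrix q).det ≠ 0 := by
    intro h
    have := congrArg Matrix.det hA
    rw [Matrix.det_mul, Matrix.det_mul, h, mul_zero, zero_mul, standardGram, Matrix.det_diagonal]
      at this
    refine Finset.prod_ne_zero_iff.mpr (fun i _ => ?_) this.symm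
    split_ifs <;> norm_num
  have h2 : q.toMatrix'.det ≠ 0 := by
    intro h
    apply h1
    have h3 : gramMatrix q = (Rat.castHom ℝ).mapMatrix q.toMatrix' := rfl
    rw [h3, ← RingHom.map_det, h, map_zero]
  exact LinearMap.BilinForm.nondegenerate_toBilin'_of_det_ne_zero' _ h2

namespace ArithmeticHyperbolicManifold

variable {n : ℕ} {q : QuadraticForm ℚ (Fin (n + 2) → ℚ)} (M : ArithmeticHyperbolicManifold q)
  {y : Fin (n + 2) → ℝ}

theorem exists_ratMatrix_of_mem_cuspInt {g : M.cuspGroup y} (hg : g ∈ M.cuspInt y) :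
    ∃ Z : Matrix (Fin (n + 2)) (Fin (n + 2)) ℚ, g.1.val = Z.map fun a : ℚ => (a : ℝ) := by
  obtain ⟨-, ⟨z, hz⟩⟩ := hg
  have hz' : (Matrix.GeneralLinearGroup.map (n := Fin (n + 2)) (Int.castRingHom ℝ)) z = g.1 := hz
  refine ⟨z.val.map fun a : ℤ => (a : ℚ), ?_⟩
  rw [← hz']
  ext i j
  simp

theorem exists_orthogonal_not_mem_span (hn : 0 < n) (y : Fin (n + 2) → ℝ) :
    ∃ w, realForm q w y = 0 ∧ ∀ c : ℝ, w ≠ c • y := by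
  by_contra! h
  have hle : LinearMap.ker (realForm q y) ≤ Submodule.span ℝ {y} := by
    intro w hw
    obtain ⟨c, hc⟩ := h w ((realForm_comm q w y).trans hw)
    exact Submodule.mem_span_singleton.mpr ⟨c, hc.symm⟩
  have h1 := Submodule.finrank_mono hle
  have h2 : Module.finrank ℝ (Submodule.span ℝ {y}) ≤ 1 := (finrank_span_le_card ({y} : Set (Fin (n + 2) → ℝ))).trans (by simp)
  have h3 := LinearMap.finrank_range_add_finrank_ker (realForm q y)
  have h4 : Module.finrank ℝ (LinearMap.range (realForm q y)) ≤ 1 := by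
    simpa using Submodule.finrank_le (LinearMap.range (realForm q y))
  rw [Module.finrank_fin_fun] at h3
  omega

/-- The fixed light-like line of a cusp is rational. -/
theorem exists_rational_lightlike [CompactSpace (M.CrossSection y)] (hn : 0 < n)
    {x₀ : Fin (n + 2) → ℝ} (hy : realForm q y y = 0) (hx₀ : x₀ ∈ M.horosphere y)
    (T : Subgroup (M.cuspGroup y)) [T.FiniteIndex] (hT : ∀ t ∈ T, M.IsUnipotent t) :
    ∃ y₀ : Fin (n + 2) → ℚ, ∃ c : ℝ, c ≠ 0 ∧ y = c • ratVec _ y₀ := by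
  obtain ⟨h, h'⟩ := (M.mem_horosphere_iff hy hx₀ x₀).mp hx₀
  have hz : realForm q x₀ y ≠ 0 := by rw [h']; norm_num
  obtain ⟨w, hwy, hw⟩ := exists_orthogonal_not_mem_span (q := q) hn y
  -- If every integral element of `T` translated orthogonally to `w`, then `w` would lie in `ℝ y`.
  obtain ⟨t, ⟨htT, htZ⟩, ht⟩ : ∃ t ∈ T ⊓ M.cuspInt y, realForm q w (t.1.val *ᵥ x₀ - x₀) ≠ 0 := by
    by_contra! hc
    obtain ⟨c, hc⟩ := M.exists_eq_smul_of_orthogonal_translations hy hx₀ (T ⊓ M.cuspInt y)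
      (fun t ht => hT t ht.1) hz hwy hc
    exact hw c hc
  set d := t.1.val *ᵥ x₀ - x₀ with hd
  have hdy : realForm q d y = 0 := by
    rw [hd, map_sub, LinearMap.sub_apply, M.realForm_mulVec_right, sub_self]
  have hdd : realForm q d d ≠ 0 := by
    intro h0
    obtain ⟨c, hc⟩ := (M.nonneg_of_orthogonal hy hx₀ hdy).2 h0
    rw [hc, map_smul, hwy, smul_zero] at ht
    exact ht rfl
  obtain ⟨Z, hZ⟩ := M.exists_ratMatrix_of_mem_cuspInt htZ
  -- The operator `(t - 1)²` has image in `ℝ y` and sends `x₀` to `q(d) y ≠ 0`. Being rational, it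
  -- has a non-zero rational column proportional to `y`.
  let N : Matrix (Fin (n + 2)) (Fin (n + 2)) ℝ := (t.1.val - 1) * (t.1.val - 1)
  have hN (v : Fin (n + 2) → ℝ) : ∃ c : ℝ, N *ᵥ v = c • y := by
    have h1 : realForm q (t.1.val *ᵥ v - v) y = 0 := by
      rw [map_sub, LinearMap.sub_apply, M.realForm_mulVec_right, sub_self]
    obtain ⟨c, hc⟩ := hT t htT _ h1
    refine ⟨c, ?_⟩
    rw [← Matrix.mulVec_mulVec]
    simp only [Matrix.sub_mulVec, Matrix.one_mulVec]
    rw [hc]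
    abel
  have hN0 : N ≠ 0 := by
    intro h0
    have h1 : N *ᵥ x₀ = realForm q d d • y := by
      rw [← Matrix.mulVec_mulVec]
      simp only [Matrix.sub_mulVec, Matrix.one_mulVec]
      rw [← hd, (hT t htT).mulVec_eq hz hdy, ← hd, h']
      module
    rw [h0, Matrix.zero_mulVec] at h1
    rcases smul_eq_zero.mp h1.symm with h2 | h2
    · exact hdd h2
    · rw [h2, map_zero] at hz
      exact hz rfl
  obtain ⟨i, j, hij⟩ : ∃ i j, N i j ≠ 0 := by
    by_contra! hc
    exact hN0 (Matrix.ext hc)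
  obtain ⟨c, hc⟩ := hN (Pi.single j 1)
  let Z' : Matrix (Fin (n + 2)) (Fin (n + 2)) ℚ := (Z - 1) * (Z - 1)
  have hNZ : N = Z'.map fun a : ℚ => (a : ℝ) := by
    have h1 : t.1.val = (Rat.castHom ℝ).mapMatrix Z := hZ
    change _ = (Rat.castHom ℝ).mapMatrix Z'
    simp only [N, Z', h1, map_mul, map_sub, map_one]
  have hcol : N *ᵥ Pi.single j 1 = ratVec _ (Z'.col j) := by
    rw [Matrix.mulVec_single_one, hNZ]
    rfl
  have hc0 : c ≠ 0 := by
    rintro rfl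
    apply hij
    have := congrFun hc i
    simpa using this
  refine ⟨Z'.col j, c⁻¹, inv_ne_zero hc0, ?_⟩
  rw [← hcol, hc, smul_smul, inv_mul_cancel₀ hc0, one_smul]

/-- Modulo `y`, translation parts add up. This recovers the translation part of `g` from that of an
integral power. -/
theorem exists_pow_mulVec_sub_eq {g : M.cuspGroup y} (hg : M.IsUnipotent g) (z : Fin (n + 2) → ℝ)
    (k : ℕ) : ∃ c : ℝ, (g ^ k).1.val *ᵥ z - z = (k : ℝ) • (g.1.val *ᵥ z - z) + c • y := by
  induction k with
  | zero => exact ⟨0, by simp⟩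
  | succ k ih =>
    obtain ⟨c, hc⟩ := ih
    have h1 : realForm q (g.1.val *ᵥ z - z) y = 0 := by
      rw [map_sub, LinearMap.sub_apply, M.realForm_mulVec_right, sub_self]
    obtain ⟨c', hc'⟩ := hg _ h1
    refine ⟨k * c' + c, ?_⟩
    have h2 : (g ^ (k + 1)).1.val *ᵥ z = g.1.val *ᵥ ((g ^ k).1.val *ᵥ z) := by
      rw [pow_succ', Matrix.mulVec_mulVec]
      rfl
    rw [h2, sub_eq_iff_eq_add.mp hc, Matrix.mulVec_add, Matrix.mulVec_add, Matrix.mulVec_smul,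
      Matrix.mulVec_smul, M.cuspGroup_mulVec, hc']
    push_cast
    module

end ArithmeticHyperbolicManifold

/-! ### Rational hyperbolic planes -/

theorem LinearMap.BilinForm.exists_hyperbolic_pair {V : Type*} [AddCommGroup V] [Module ℚ V]
    {b : LinearMap.BilinForm ℚ V} (hs : b.IsSymm) (hn : b.Nondegenerate) {y : V}
    (hy0 : y ≠ 0) (hy : b y y = 0) : ∃ z, b y z = 1 ∧ b z z = 0 := by
  obtain ⟨x, hx⟩ : ∃ x, b y x ≠ 0 := by
    by_contra! hc
    exact hy0 (hn.1 y hc)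
  let u := (b y x)⁻¹ • x
  have hu : b y u = 1 := by simp [u, hx]
  have hu' : b u y = 1 := (hs.eq u y).trans hu
  refine ⟨u - (b u u / 2) • y, ?_, ?_⟩
  · simp [hu, hy]
  · simp only [map_sub, map_smul, LinearMap.sub_apply, LinearMap.smul_apply, hu, hu', hy, smul_eq_mul]
    ring

/-- The orthogonal complement of a hyperbolic plane. -/
theorem LinearMap.BilinForm.hasGramDet_of_hyperbolic_pair {V : Type*} [AddCommGroup V] [Module ℚ V]
    [FiniteDimensional ℚ V] {b : LinearMap.BilinForm ℚ V} (hs : b.IsSymm) {y z : V}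
    (hy : b y y = 0) (hyz : b y z = 1) (hz : b z z = 0) {W : Submodule ℚ V}
    (hW : ∀ v, v ∈ W ↔ b y v = 0 ∧ b z v = 0) {d : ℚ} (hd : (b.restrict W).HasGramDet d) :
    b.HasGramDet (-d) ∧ Module.finrank ℚ V = Module.finrank ℚ W + 2 := by
  have hzy : b z y = 1 := (hs.eq z y).trans hyz
  have hlin : LinearIndependent ℚ ![y, z] := by
    rw [LinearIndependent.pair_iff]
    intro s t hst
    have h1 := congrArg (b y) hst
    have h2 := congrArg (b z) hst
    simp [hy, hyz, hz, hzy] at h1 h2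
    exact ⟨h2, h1⟩
  let P : Submodule ℚ V := Submodule.span ℚ (Set.range ![y, z])
  let e : Module.Basis (Fin 2) ℚ P := Module.Basis.span hlin
  have he0 : (e 0 : V) = y := congrArg Subtype.val (Module.Basis.span_apply hlin 0)
  have he1 : (e 1 : V) = z := congrArg Subtype.val (Module.Basis.span_apply hlin 1)
  have hdet : (BilinForm.toMatrix e (b.restrict P)).det = -1 * 1 ^ 2 := by
    rw [Matrix.det_fin_two]
    simp [BilinForm.toMatrix_apply, he0, he1, hy, hyz, hz, hzy]
  have hP : (b.restrict P).Nondegenerate :=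
    BilinForm.nondegenerate_of_det_ne_zero _ e (by rw [hdet]; norm_num)
  have hWP : W = b.orthogonal P := by
    ext v
    rw [hW]
    constructor
    · rintro ⟨h1, h2⟩ u hu
      have hle : P ≤ LinearMap.ker (b.flip v) := by
        rw [Submodule.span_le]
        rintro _ ⟨i, rfl⟩
        fin_cases i
        · exact h1
        · exact h2
      exact hle hu
    · intro h
      exact ⟨h y (Submodule.subset_span ⟨0, rfl⟩), h z (Submodule.subset_span ⟨1, rfl⟩)⟩
  have hc : IsCompl P W := by
    rw [hWP]
    exact b.isCompl_orthogonal_of_restrict_nondegenerate hs.isRefl hP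
  constructor
  · have := HasGramDet.mul_of_isCompl hc (fun x hx v hv => (hWP ▸ hv : v ∈ b.orthogonal P) x hx)
      (fun x hx v hv => hs.isRefl _ _ ((hWP ▸ hv : v ∈ b.orthogonal P) x hx))
      (HasGramDet.of_basis e one_ne_zero hdet) hd
    simpa using this
  · have h1 := Submodule.finrank_add_eq_of_isCompl hc
    have h2 : Module.finrank ℚ P = 2 := by simpa using finrank_span_eq_card hlin
    omega

/-! ### The rational action and the discriminant -/

namespace ArithmeticHyperbolicManifold

variable {n : ℕ} {q : QuadraticForm ℚ (Fin (n + 2) → ℚ)} (M : ArithmeticHyperbolicManifold q)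
  {y : Fin (n + 2) → ℝ}

/-- The cusp group acts rationally on the rational quadratic space `yᗮ / ℚ y`, realized as the
orthogonal complement `W` of a rational hyperbolic plane containing the line of the cusp. -/
theorem exists_rational_mulVec [CompactSpace (M.CrossSection y)] {x₀ : Fin (n + 2) → ℝ}
    (hy : realForm q y y = 0) (hx₀ : x₀ ∈ M.horosphere y) (T : Subgroup (M.cuspGroup y)) [T.Normal]
    [T.FiniteIndex] (hT : ∀ t ∈ T, M.IsUnipotent t) {y₀ z₀ : Fin (n + 2) → ℚ} {a : ℝ} (ha : a ≠ 0)
    (hya : y = a • ratVec _ y₀) (hyz : ratForm q y₀ z₀ = 1) {W : Submodule ℚ (Fin (n + 2) → ℚ)}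
    (hW : ∀ v, v ∈ W ↔ ratForm q y₀ v = 0 ∧ ratForm q z₀ v = 0)
    (hani : ∀ v ∈ W, ratForm q v v = 0 → v = 0) (hy₀ : ratForm q y₀ y₀ = 0)
    (hWy : ∀ v ∈ W, ∀ c : ℝ, ratVec _ v = c • y → v = 0)
    (g : M.cuspGroup y) (v : Fin (n + 2) → ℚ) (hv : v ∈ W) :
    ∃ u ∈ W, ∃ c : ℝ, g.1.val *ᵥ ratVec _ v = ratVec _ u + c • y := by
  have hya' : ratVec _ y₀ = a⁻¹ • y := by rw [hya, smul_smul, inv_mul_cancel₀ ha, one_smul]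
  have hyr (r : Fin (n + 2) → ℚ) : realForm q (ratVec _ r) y = a * (ratForm q y₀ r : ℝ) := by
    rw [hya, map_smul, realForm_ratVec, ratForm_comm, smul_eq_mul]
  have hz : realForm q (ratVec _ z₀) y ≠ 0 := by
    rw [hyr, hyz]
    simpa using ha
  have hdecomp (r : Fin (n + 2) → ℚ) (hr : ratForm q y₀ r = 0) :
      ∃ u ∈ W, ∃ s : ℚ, r = u + s • y₀ := by
    refine ⟨r - ratForm q z₀ r • y₀, (hW _).mpr ⟨?_, ?_⟩, ratForm q z₀ r, by simp⟩
    · simp [hr, hy₀]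
    · simp [ratForm_comm q z₀ y₀, hyz]
  have htrans (t : M.cuspGroup y) (ht : t ∈ M.cuspInt y) : ∃ u ∈ W, ∃ c : ℝ,
      t.1.val *ᵥ ratVec _ z₀ - ratVec _ z₀ = ratVec _ u + c • y := by
    obtain ⟨Z, hZ⟩ := M.exists_ratMatrix_of_mem_cuspInt ht
    have h1 : t.1.val *ᵥ ratVec _ z₀ - ratVec _ z₀ = ratVec _ (Z *ᵥ z₀ - z₀) := by
      rw [hZ, ratVec_mulVec, map_sub]
    have h2 : ratForm q y₀ (Z *ᵥ z₀ - z₀) = 0 := by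
      have h3 := hyr (Z *ᵥ z₀ - z₀)
      rw [← h1, map_sub, LinearMap.sub_apply, M.realForm_mulVec_right, sub_self] at h3
      have := (mul_eq_zero.mp h3.symm).resolve_left ha
      exact_mod_cast this
    obtain ⟨u, hu, s, hs⟩ := hdecomp _ h2
    refine ⟨u, hu, s * a⁻¹, ?_⟩
    rw [h1, hs, map_add, ratVec_smul, hya', smul_smul]
  -- The vectors of `W` that `g` sends to rational ones modulo `y`; the goal is that all of `W`
  -- qualifies.
  let S : Submodule ℚ W :=
    { carrier := {v | ∃ u ∈ W, ∃ c : ℝ, g.1.val *ᵥ ratVec _ v.1 = ratVec _ u + c • y}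
      zero_mem' := ⟨0, W.zero_mem, 0, by simp⟩
      add_mem' := by
        rintro v w ⟨u, hu, c, h⟩ ⟨u', hu', c', h'⟩
        refine ⟨u + u', W.add_mem hu hu', c + c', ?_⟩
        rw [Submodule.coe_add, map_add, Matrix.mulVec_add, h, h', map_add]
        module
      smul_mem' := by
        rintro s v ⟨u, hu, c, h⟩
        refine ⟨s • u, W.smul_mem s hu, s * c, ?_⟩
        rw [Submodule.coe_smul, ratVec_smul, Matrix.mulVec_smul, h, ratVec_smul]
        module }
  -- Modulo `y`, `g` sends the translation part of `t` to that of `s = g t g⁻¹`. A power `s ^ N` is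
  -- integral, so the latter is `1 / N` times a rational vector.
  have hS (t : M.cuspGroup y) (htT : t ∈ T) (w : W) (c : ℝ)
      (h : t.1.val *ᵥ ratVec _ z₀ - ratVec _ z₀ = ratVec _ w.1 + c • y) : w ∈ S := by
    let s := g * t * g⁻¹
    have hsT : s ∈ T := ‹T.Normal›.conj_mem t htT g
    have hs : s.1.val *ᵥ (g.1.val *ᵥ ratVec _ z₀) = g.1.val *ᵥ (t.1.val *ᵥ ratVec _ z₀) := by
      rw [Matrix.mulVec_mulVec, Matrix.mulVec_mulVec]
      have : s * g = g * t := by simp [s]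
      exact congrArg (fun k : M.cuspGroup y => k.1.val *ᵥ ratVec _ z₀) this
    have hgz : realForm q (g.1.val *ᵥ ratVec _ z₀ - ratVec _ z₀) y = 0 := by
      rw [map_sub, LinearMap.sub_apply, M.realForm_mulVec_right, sub_self]
    obtain ⟨c₁, hc₁⟩ := hT s hsT _ hgz
    obtain ⟨N, hN0, -, hN⟩ := Subgroup.exists_pow_mem_of_index_ne_zero
      (H := M.cuspInt y) Subgroup.FiniteIndex.index_ne_zero s
    obtain ⟨c₂, hc₂⟩ := M.exists_pow_mulVec_sub_eq (hT s hsT) (ratVec _ z₀) N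
    obtain ⟨u, hu, c₃, hc₃⟩ := htrans _ hN
    rw [hc₂] at hc₃
    have hN0' : (N : ℝ) ≠ 0 := Nat.cast_ne_zero.mpr hN0.ne'
    refine ⟨(N : ℚ)⁻¹ • u, W.smul_mem _ hu, c₁ - c + (N : ℝ)⁻¹ * (c₃ - c₂), ?_⟩
    have h1 : ratVec _ w.1 = t.1.val *ᵥ ratVec _ z₀ - ratVec _ z₀ - c • y := by rw [h]; abel
    have h2 : s.1.val *ᵥ ratVec _ z₀ - ratVec _ z₀
        = (N : ℝ)⁻¹ • (ratVec _ u + c₃ • y - c₂ • y) := by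
      rw [← hc₃, add_sub_cancel_right, smul_smul, inv_mul_cancel₀ hN0', one_smul]
    rw [Matrix.mulVec_sub, hs] at hc₁
    rw [h1, Matrix.mulVec_sub, Matrix.mulVec_sub, Matrix.mulVec_smul, M.cuspGroup_mulVec,
      sub_eq_iff_eq_add.mp hc₁, ratVec_smul, sub_eq_iff_eq_add.mp h2]
    push_cast
    module
  suffices htop : S = ⊤ from (htop ▸ Submodule.mem_top : (⟨v, hv⟩ : W) ∈ S)
  have hsymm : ((ratForm q).restrict W).IsSymm := ⟨fun x w => ratForm_comm q x w⟩
  apply LinearMap.BilinForm.eq_top_of_restrict_nondegenerate_of_orthogonal_eq_bot hsymm.isRefl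
  · exact ⟨fun x hx => Subtype.ext (Subtype.ext (hani _ x.1.2 (hx x))),
      fun x hx => Subtype.ext (Subtype.ext (hani _ x.1.2 (hx x)))⟩
  -- A vector orthogonal to `S` is orthogonal to the translation parts of all integral elements of
  -- `T`, so it lies in `W ∩ ℝ y = 0`.
  · rw [eq_bot_iff]
    intro w hw
    have hwy : realForm q (ratVec _ w.1) y = 0 := by
      rw [hyr, ((hW _).mp w.2).1]
      simp
    obtain ⟨c, hc⟩ := M.exists_eq_smul_of_orthogonal_translations hy hx₀ (T ⊓ M.cuspInt y)
      (fun t ht => hT t ht.1) hz hwy (by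
        intro t ht
        obtain ⟨u, hu, c, hc⟩ := htrans t ht.2
        have h1 : ratForm q u w.1 = 0 := hw ⟨u, hu⟩ (hS t ht.1 ⟨u, hu⟩ c hc)
        rw [hc, map_add, map_smul, hwy, realForm_ratVec, ratForm_comm, h1]
        simp)
    exact Subtype.ext (hWy w.1 w.2 c hc)

/-- The hypothesis `hper` is the form in which the vanishing of `b₁` enters: it excludes common
fixed vectors in `W`. -/
theorem discr_of_trivial_periods [CompactSpace (M.CrossSection y)] {k p : ℕ} (hn : 0 < n)
    (hp : p.Prime) (hodd : Odd p) {x₀ : Fin (n + 2) → ℝ}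
    (hy : realForm q y y = 0) (hx₀ : x₀ ∈ M.horosphere y)
    (F : M.cuspGroup y →* Multiplicative (Fin k → ZMod p))
    (hF : ∀ s t, F s = 1 → F t = 1 → s * t = t * s)
    (hper : ∀ (f : M.horosphere y → ℝ) (c : M.cuspGroup y → ℝ),
      (∀ g x, f (g • x) = f x + c g) → ∀ g, c g = 0) :
    ∃ m, n = m * (p - 1) ∧ ∃ r : ℚ, r ≠ 0 ∧ q.discr' = -(p : ℚ) ^ m * r ^ 2 := by
  -- Makes the target of `F` finite, so that `F.ker` has finite index.
  have : NeZero p := ⟨hp.ne_zero⟩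
  have : F.ker.FiniteIndex := inferInstance
  have hT (t : M.cuspGroup y) (ht : t ∈ F.ker) : M.IsUnipotent t :=
    M.isUnipotent_of_commute hy hx₀ F.ker fun s hs => hF t s ht hs
  obtain ⟨y₀, a, ha, hya⟩ := M.exists_rational_lightlike hn hy hx₀ F.ker hT
  have hxy : realForm q x₀ y = -1 := ((M.mem_horosphere_iff hy hx₀ x₀).mp hx₀).2
  have hy0 : y₀ ≠ 0 := by
    rintro rfl
    rw [map_zero, smul_zero] at hya
    rw [hya, map_zero] at hxy
    norm_num at hxy
  have hyr (r : Fin (n + 2) → ℚ) : realForm q (ratVec _ r) y = a * (ratForm q y₀ r : ℝ) := by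
    rw [hya, map_smul, realForm_ratVec, ratForm_comm, smul_eq_mul]
  have hy₀ : ratForm q y₀ y₀ = 0 := by
    have h1 : a * (a * (ratForm q y₀ y₀ : ℝ)) = 0 := by
      rw [← hyr, ← smul_eq_mul, ← LinearMap.smul_apply, ← map_smul, ← hya, hy]
    have := (mul_eq_zero.mp ((mul_eq_zero.mp h1).resolve_left ha)).resolve_left ha
    exact_mod_cast this
  obtain ⟨z₀, hyz, hzz⟩ := LinearMap.BilinForm.exists_hyperbolic_pair (ratForm_isSymm q)
    M.isModelMatrix.ratForm_nondegenerate hy0 hy₀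
  let W : Submodule ℚ (Fin (n + 2) → ℚ) :=
    LinearMap.ker (ratForm q y₀) ⊓ LinearMap.ker (ratForm q z₀)
  have hW (v) : v ∈ W ↔ ratForm q y₀ v = 0 ∧ ratForm q z₀ v = 0 := Iff.rfl
  have hWortho (v : Fin (n + 2) → ℚ) (hv : v ∈ W) : realForm q (ratVec _ v) y = 0 := by
    rw [hyr, ((hW v).mp hv).1]
    simp
  have hWy (v) (hv : v ∈ W) (c : ℝ) (hc : ratVec _ v = c • y) : v = 0 := by
    have h1 : realForm q (ratVec _ z₀) (ratVec _ v) = 0 := by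
      rw [realForm_ratVec, ((hW v).mp hv).2]
      simp
    rw [hc, map_smul, hyr, hyz, smul_eq_mul] at h1
    have hc0 : c = 0 := by simpa [ha] using h1
    rw [hc0, zero_smul] at hc
    exact ratVec_injective (hc.trans (map_zero _).symm)
  -- Images in `W` are unique modulo `y`; linearity, commutation and the relation `L ^ p = 1` all
  -- follow from this.
  have huniq (u u' : W) (c c' : ℝ) (h : ratVec _ u.1 + c • y = ratVec _ u'.1 + c' • y) : u = u' := by
    apply sub_eq_zero.mp
    refine Subtype.ext (hWy _ (u - u').2 (c' - c) ?_)
    rw [Submodule.coe_sub, map_sub, sub_smul, sub_eq_sub_iff_add_eq_add, h]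
    abel
  have hani (v) (hv : v ∈ W) (h : ratForm q v v = 0) : v = 0 := by
    obtain ⟨c, hc⟩ := (M.nonneg_of_orthogonal hy hx₀ (hWortho v hv)).2 (by
      rw [realForm_ratVec, h, Rat.cast_zero])
    exact hWy v hv c hc
  choose A hA c hc using fun (g : M.cuspGroup y) (v : W) =>
    M.exists_rational_mulVec hy hx₀ F.ker hT ha hya hyz hW hani hy₀ hWy g v.1 v.2
  have hlin (g : M.cuspGroup y) : ∃ L : W →ₗ[ℚ] W, ∀ v : W, ∃ c : ℝ,
      g.1.val *ᵥ ratVec _ v.1 = ratVec _ (L v).1 + c • y := by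
    refine ⟨{ toFun := fun v => ⟨A g v, hA g v⟩, map_add' := fun v w => ?_,
              map_smul' := fun s v => ?_ }, fun v => ⟨c g v, hc g v⟩⟩
    · apply huniq _ _ (c g (v + w)) (c g v + c g w)
      rw [← hc g (v + w), Submodule.coe_add, map_add, Matrix.mulVec_add, hc, hc, Submodule.coe_add,
        map_add]
      module
    · apply huniq _ _ (c g (s • v)) (s * c g v)
      rw [← hc g (s • v), RingHom.id_apply, Submodule.coe_smul, Submodule.coe_smul, ratVec_smul,
        ratVec_smul, Matrix.mulVec_smul, hc]
      module
  let S : Set (W →ₗ[ℚ] W) := {L | ∃ g : M.cuspGroup y, ∀ v : W, ∃ c : ℝ,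
      g.1.val *ᵥ ratVec _ v.1 = ratVec _ (L v).1 + c • y}
  have hmul {g h : M.cuspGroup y} {L L' : W →ₗ[ℚ] W}
      (hg : ∀ v : W, ∃ c : ℝ, g.1.val *ᵥ ratVec _ v.1 = ratVec _ (L v).1 + c • y)
      (hh : ∀ v : W, ∃ c : ℝ, h.1.val *ᵥ ratVec _ v.1 = ratVec _ (L' v).1 + c • y) (v : W) :
      ∃ c : ℝ, (g * h).1.val *ᵥ ratVec _ v.1 = ratVec _ ((L * L') v).1 + c • y := by
    obtain ⟨c, hc⟩ := hh v
    obtain ⟨c', hc'⟩ := hg (L' v)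
    refine ⟨c' + c, ?_⟩
    have : (g * h).1.val *ᵥ ratVec _ v.1 = g.1.val *ᵥ (h.1.val *ᵥ ratVec _ v.1) := by
      rw [Matrix.mulVec_mulVec]
      rfl
    rw [this, hc, Matrix.mulVec_add, Matrix.mulVec_smul, M.cuspGroup_mulVec, hc',
      Module.End.mul_apply]
    module
  have hone {t : M.cuspGroup y} (ht : F t = 1) (v : W) :
      ∃ c : ℝ, t.1.val *ᵥ ratVec _ v.1 = ratVec _ ((1 : W →ₗ[ℚ] W) v).1 + c • y :=
    hT t ht _ (hWortho v.1 v.2)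
  obtain ⟨m, hm, hd⟩ := LinearMap.BilinForm.hasGramDet_of_commuting_isometries hp hodd
    (B := (ratForm q).restrict W) ⟨fun x w => ratForm_comm q x w⟩
    (fun v hv => Subtype.ext (hani _ v.2 hv)) S
    (by
      rintro L ⟨g, hg⟩ L' ⟨h, hh⟩
      ext1 v
      -- Commutators lie in the kernel of `F`, which acts trivially on `W`.
      have ht : F ((h * g)⁻¹ * (g * h)) = 1 := by
        rw [map_mul, map_inv, map_mul, map_mul, mul_comm (F h), inv_mul_cancel]
      obtain ⟨c, hc⟩ := hmul hg hh v
      obtain ⟨c', hc'⟩ := hmul (hmul hh hg) (hone ht) v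
      rw [mul_inv_cancel_left, hc, mul_one] at hc'
      exact huniq _ _ _ _ hc')
    (by
      rintro L ⟨g, hg⟩
      have hpow (j : ℕ) : ∀ v : W, ∃ c : ℝ,
          (g ^ j).1.val *ᵥ ratVec _ v.1 = ratVec _ ((L ^ j) v).1 + c • y := by
        induction j with
        | zero => exact fun v => ⟨0, by simp⟩
        | succ j ih =>
          rw [pow_succ, pow_succ]
          exact hmul ih hg
      have ht : F (g ^ p) = 1 := by
        rw [map_pow]
        apply Multiplicative.toAdd.injective
        ext i
        simp
      ext1 v
      obtain ⟨c, hc⟩ := hpow p v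
      obtain ⟨c', hc'⟩ := hone ht v
      exact huniq _ _ c c' (hc.symm.trans hc'))
    (by
      rintro L ⟨g, hg⟩ v w
      obtain ⟨c, hc⟩ := hg v
      obtain ⟨c', hc'⟩ := hg w
      have h1 := M.cuspGroup_isometry g (ratVec _ v.1) (ratVec _ w.1)
      rw [hc, hc', map_add, map_add, LinearMap.add_apply, LinearMap.add_apply, map_smul, map_smul,
        map_smul, LinearMap.smul_apply, LinearMap.smul_apply, hy, hWortho _ (L v).2,
        realForm_comm q y, hWortho _ (L w).2, realForm_ratVec, realForm_ratVec] at h1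
      simp only [smul_zero, add_zero] at h1
      exact_mod_cast h1)
    (by
      intro v hv
      -- With `g v = v + e y`, pairing against a horosphere point gives `(v, g x) = (v, x) + e`, so
      -- `e` is a period and vanishes. The function `(v, ·)` is then invariant and bounded, and `v =
      -- 0`.
      have hfix (g : M.cuspGroup y) : ∃ c : ℝ, g.1.val *ᵥ ratVec _ v.1 = ratVec _ v.1 + c • y := by
        obtain ⟨L, hL⟩ := hlin g
        obtain ⟨c, hc⟩ := hL v
        rw [hv L ⟨g, hL⟩] at hc
        exact ⟨c, hc⟩
      choose e he using hfix
      have hf (g : M.cuspGroup y) (x : M.horosphere y) :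
          realForm q (ratVec _ v.1) (g • x).1 = realForm q (ratVec _ v.1) x.1 + e g := by
        have h1 := M.cuspGroup_isometry g (ratVec _ v.1) x.1
        have h2 := ((M.mem_horosphere_iff hy hx₀ _).mp (g • x).2).2
        rw [M.coe_smul_horosphere] at h2 ⊢
        rw [he, map_add, LinearMap.add_apply, map_smul, LinearMap.smul_apply, realForm_comm q y,
          h2, smul_eq_mul] at h1
        linarith
      have he0 := hper (fun x => realForm q (ratVec _ v.1) x.1) e hf
      obtain ⟨C, hC⟩ := exists_bound_of_finiteIndex_invariant (⊤ : Subgroup (M.cuspGroup y))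
        (f := fun x : M.horosphere y => realForm q (ratVec _ v.1) x.1)
        (continuous_realForm q continuous_const continuous_subtype_val)
        (fun g _ x => by rw [hf, he0, add_zero])
      obtain ⟨c, hc⟩ := M.exists_eq_smul_of_bounded hy hx₀ (hWortho v.1 v.2)
        fun x hx => hC ⟨x, hx⟩
      exact Subtype.ext (hWy _ v.2 c hc))
  obtain ⟨hd', hdim⟩ := LinearMap.BilinForm.hasGramDet_of_hyperbolic_pair (ratForm_isSymm q)
    hy₀ hyz hzz hW hd
  refine ⟨m, ?_, ?_⟩
  · rw [Module.finrank_fin_fun] at hdim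
    omega
  · obtain ⟨r, hr, h⟩ := hd'.det_toMatrix (Pi.basisFun ℚ (Fin (n + 2)))
    refine ⟨r, hr, ?_⟩
    rw [← h, LinearMap.BilinForm.toMatrix_basisFun, ratForm]
    simp [QuadraticForm.discr']

end ArithmeticHyperbolicManifold

/-! ### Conclusion by the parity of `m` -/

theorem theorem1p5 {n k p : ℕ} (hn : 0 < n) (hp : p.Prime) (hp_odd : Odd p)
    (B : CompactFlatManifold n)
    (hol : Nonempty (B.holonomyGroup ≃* Multiplicative (Fin k → ZMod p)))
    (hb : B.b₁ = 0)
    (q : QuadraticForm ℚ (Fin (n + 2) → ℚ)) (hq : HasSignature q (n + 1) 1)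
    (hB : IsCuspCrossSectionInClass B q) :
    (n ≡ 0 [MOD 2 * (p - 1)] ∨ n ≡ p - 1 [MOD 2 * (p - 1)]) ∧
    (n ≡ 0 [MOD 2 * (p - 1)] → HasDiscriminant q (-1)) ∧
    (n ≡ p - 1 [MOD 2 * (p - 1)] → HasDiscriminant q (-(p : ℚ))) := by
  obtain ⟨M, y, -, hyy, ⟨ψ⟩⟩ := hB
  have hy : realForm q y y = 0 := (realForm_apply q y y).trans hyy
  obtain ⟨⟨x₀, hx₀⟩, -⟩ := Quotient.exists_rep (ψ (Quotient.mk _ (0 : Euc n)))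
  have := M.contractibleSpace_horosphere hy hx₀
  have := B.compact
  have : CompactSpace (M.CrossSection y) := ψ.compactSpace
  obtain ⟨F, hF⟩ := M.exists_hom_with_commutative_ker hy hx₀ B ψ hol
  have hcov := (M.isQuotientCoveringMap_horosphere hy hx₀).homeomorph_comp ψ.symm
  obtain ⟨m, hm, r, hr, hd⟩ := M.discr_of_trivial_periods hn hp hp_odd hy hx₀ F hF
    fun f c hf g => hcov.period_eq_zero (X := TopCat.of B.Space) hb f c hf g
  have hp1 : 0 < p - 1 := Nat.sub_pos_of_lt hp.one_lt
  have hp0 : (p : ℚ) ≠ 0 := Nat.cast_ne_zero.mpr hp.ne_zero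
  rcases Nat.even_or_odd' m with ⟨j, rfl | rfl⟩
  · have h0 : n ≡ 0 [MOD 2 * (p - 1)] :=
      (Nat.modEq_zero_iff_dvd).mpr ⟨j, by rw [hm]; ring⟩
    refine ⟨Or.inl h0, fun _ => ⟨p ^ j * r, mul_ne_zero (pow_ne_zero _ hp0) hr, ?_⟩, fun h1 => ?_⟩
    · rw [hd]
      ring
    -- The two congruences exclude each other because `0 < p - 1 < 2 (p - 1)`.
    · have h2 := Nat.le_of_dvd hp1 ((Nat.modEq_zero_iff_dvd).mp (h1.symm.trans h0))
      omega
  · have h0 : n ≡ p - 1 [MOD 2 * (p - 1)] := by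
      rw [hm, show (2 * j + 1) * (p - 1) = p - 1 + 2 * (p - 1) * j by ring]
      simp [Nat.ModEq]
    refine ⟨Or.inr h0, fun h1 => ?_, fun _ => ⟨p ^ j * r, mul_ne_zero (pow_ne_zero _ hp0) hr, ?_⟩⟩
    · have h2 := Nat.le_of_dvd hp1 ((Nat.modEq_zero_iff_dvd).mp (h0.symm.trans h1))
      omega
    · rw [hd]
      ring
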